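/- **Proposition (second generation dynamical constraints can be expressed as $\mathcal{FL}$-projectable functions).** Let $Q$ be a smooth, finite-dimensional, Hausdorff, second countable manifold, let $T^1_kQ=TQ\oplus_Q\overset{k}{\cdots}\oplus_Q TQ$ be its $k$-tangent bundle, with points $(q;v_1,\dots,v_k)$ and projection $\pi\colon T^1_kQ\to Q$, and let $(T^1_k)^*Q=T^*Q\oplus_Q\overset{k}{\cdots}\oplus_Q T^*Q$. For a smooth function $\mathcal L\colon T^1_kQ\to\mathbb R$ put $$\theta^\alpha_{\mathcal L}=(J^\alpha)^*d\mathcal L,\qquad \omega^\alpha_{\mathcal L}=-d\theta^\alpha_{\mathcal L},\qquad \mathcal E_{\mathcal L}=\Delta(\mathcal L)-\mathcal L ,$$ where $J^\alpha=\frac{\partial}{\partial v^i_\alpha}\otimes dq^i$ ($1\le\alpha\le k$) are the vertical endomorphisms and $\Delta=\sum_\alpha v^i_\alpha\frac{\partial}{\partial v^i_\alpha}$ is the Liouville vector field. Let $\mathcal{FL}\colon T^1_kQ\to(T^1_k)^*Q$ be the Legendre map, given in coordinates by $q^i=q^i$, $p^\alpha_i=\partial\mathcal L/\partial v^i_\alpha$.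 Assume that $\mathcal L$ is almost-regular: $P_0=\mathcal{FL}(T^1_kQ)$ is a closed submanifold of $(T^1_k)^*Q$, $\mathcal{FL}\colon T^1_kQ\to P_0$ is a submersion, and its fibres are connected. A function on $T^1_kQ$ is called $\mathcal{FL}$-projectable if it is the pull-back by $\mathcal{FL}$ of a smooth function on $P_0$; a vector field $Z$ on $T^1_kQ$ is $\mathcal{FL}$-projectable if it is $\mathcal{FL}$-related to a smooth vector field on $P_0$; a $k$-vector field $\mathbf X=(X_1,\dots,X_k)$ (a $k$-tuple of smooth vector fields on $T^1_kQ$) is $\mathcal{FL}$-projectable if every $X_\alpha$ is. For a $k$-vector field $\mathbf X$ let $\mathbf\Omega_{\mathcal L}(\mathbf X)=\sum_\alpha i(X_\alpha)\omega^\alpha_{\mathcal L}$. Let $P_1$ be the set of points $x\in T^1_kQ$ at which $(d\mathcal E_{\mathcal L})_x=\sum_\alpha i(u_\alpha)(\omega^\alpha_{\mathcal L})_x$ for some $u_1,\dots,u_k\in T_x(T^1_kQ)$. A $k$-vector field $\mathbf X$ on $T^1_kQ$ is called Lagrangian on $P_1$ if $\mathbf\Omega_{\mathcal L}(\mathbf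 X)=d\mathcal E_{\mathcal L}$ at all points of $P_1$. Let $\mathrm{Ker}^V\mathbf\Omega_{\mathcal L}$ be the set of $\pi$-vertical $k$-vector fields $\mathbf V$ with $\mathbf\Omega_{\mathcal L}(\mathbf V)=0$, and let $\mathfrak Z$ be the set of smooth vector fields $Z$ on $T^1_kQ$ with $\mathbf\Omega_{\mathcal L}(\mathbf Y)(Z)=0$ for every $k$-vector field $\mathbf Y$. The first generation dynamical constraints are the functions $\zeta^{(Z)}_1=i(Z)d\mathcal E_{\mathcal L}$, $Z\in\mathfrak Z$. For $\mathbf X$ Lagrangian on $P_1$ and $\mathbf V\in\mathrm{Ker}^V\mathbf\Omega_{\mathcal L}$, the second generation dynamical constraints are the functions $$\zeta^{(Z)}_{2,\alpha}=(X_\alpha+V_\alpha)(\zeta^{(Z)}_1),\qquad 1\le\alpha\le k,\ Z\in\mathfrak Z .$$ Let $P_2$ be the set of points $x\in P_1$ for which there is a $k$-vector field $\mathbf W$, Lagrangian on $P_1$, with $W_\alpha(\zeta^{(Z)}_1)(x)=0$ for all $\alpha$ and all $Z\in\mathfrak Z$ (that is, $\mathbf W$ is tangent to $P_1$ at $x$,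 in terms of the constraints). Say that $(\mathbf X,\mathbf V)$ defines $P_2$ by means of a subset of $\mathfrak Z$ if $P_2$ is the set of points of $P_1$ at which the functions $\zeta^{(Z)}_{2,\alpha}$, with $1\le\alpha\le k$ and $Z$ in this subset, vanish. Let $\mathfrak Z_{\mathrm{pr}}$ be the set of $\mathcal{FL}$-projectable elements of $\mathfrak Z$. Then the second generation dynamical constraints can be taken to be $\mathcal{FL}$-projectable, in the following sense. 1. If $\mathbf X$ is Lagrangian on $P_1$, $\mathbf V\in\mathrm{Ker}^V\mathbf\Omega_{\mathcal L}$, $\mathbf X+\mathbf V$ is $\mathcal{FL}$-projectable and $Z\in\mathfrak Z_{\mathrm{pr}}$, then $\zeta_1^{(Z)}$ and all $\zeta^{(Z)}_{2,\alpha}=(X_\alpha+V_\alpha)(\zeta^{(Z)}_1)$ are $\mathcal{FL}$-projectable functions. 2. For every $Z\in\mathfrak Z$ and every $x\in T^1_kQ$ there is $Z'\in\mathfrak Z_{\mathrm{pr}}$ with $Z'_x=Z_x$ and $\zeta_1^{(Z')}(x)=\zeta_1^{(Z)}(x)$ and, if $x\in P_1$, with $W_\alpha(\zeta_1^{(Z')})(x)=W_\alpha(\zeta_1^{(Z)})(x)$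 for every $k$-tuple $\mathbf W$ of vector fields and every $\alpha$. 3. For every $\mathbf X$ Lagrangian on $P_1$ and every $\mathbf V\in\mathrm{Ker}^V\mathbf\Omega_{\mathcal L}$ there are $\mathbf X'$ Lagrangian on $P_1$ and $\mathbf V'\in\mathrm{Ker}^V\mathbf\Omega_{\mathcal L}$ such that $\mathbf X'+\mathbf V'$ is $\mathcal{FL}$-projectable and such that, if $(\mathbf X,\mathbf V)$ defines $P_2$ by means of $\mathfrak Z$, then $(\mathbf X',\mathbf V')$ defines $P_2$ by means of $\mathfrak Z_{\mathrm{pr}}$. 4. For every $x\in P_2$ there are $\mathbf X$ Lagrangian on $P_1$ and $\mathbf V\in\mathrm{Ker}^V\mathbf\Omega_{\mathcal L}$ such that $\mathbf X+\mathbf V$ is $\mathcal{FL}$-projectable and $(X_\alpha+V_\alpha)(\zeta_1^{(Z)})(x)=0$ for all $\alpha$ and all $Z\in\mathfrak Z_{\mathrm{pr}}$. -/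

import Mathlib

open scoped Manifold ContDiff

noncomputable section

namespace KSymp

/-! ### Generalities on manifolds without boundary -/

section Manifolds

variable {E : Type*} [NormedAddCommGroup E] [NormedSpace ℝ E]
  {H : Type*} [TopologicalSpace H] (J : ModelWithCorners ℝ E H)
  {M : Type*} [TopologicalSpace M] [ChartedSpace H M]

/-- The expression, in the preferred chart `φ` of `M` at `x`, of a differential 1-form `θ` on `M`:
the pull-back of `θ` by `φ⁻¹`, as a differential 1-form on the model vector space. -/
def formInChart (θ : ∀ x : M, TangentSpace J x →L[ℝ] ℝ) (x : M) (y : E) : E [⋀^Fin 1]→L[ℝ] ℝ :=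
  ContinuousAlternatingMap.ofSubsingleton ℝ E ℝ (0 : Fin 1)
    ((θ ((extChartAt J x).symm y)).comp (mfderiv 𝓘(ℝ, E) J (extChartAt J x).symm y))

/-- The exterior derivative `dθ` of a differential 1-form `θ` on a manifold without boundary,
evaluated at `x` on two tangent vectors (computed in the preferred chart at `x`). -/
def extDerivForm (θ : ∀ x : M, TangentSpace J x →L[ℝ] ℝ) (x : M) (u v : TangentSpace J x) : ℝ :=
  extDeriv (formInChart J θ x) (extChartAt J x x)
    ![mfderiv J 𝓘(ℝ, E) (extChartAt J x) x u, mfderiv J 𝓘(ℝ, E) (extChartAt J x) x v]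

/-- `Z` is a smooth vector field on `M`. -/
def IsSmoothVectorField [IsManifold J 1 M] (Z : ∀ x : M, TangentSpace J x) : Prop :=
  ContMDiff J J.tangent ∞ (fun x => (⟨x, Z x⟩ : TangentBundle J M))

end Manifolds

/-! ### The `k`-tangent and the `k`-cotangent bundle -/

section Bundles

variable (k : ℕ) (E : Type*) [NormedAddCommGroup E] [NormedSpace ℝ E]
  (Q : Type*) [TopologicalSpace Q] [ChartedSpace E Q]

/-- The fibre of `T¹ₖQ` at `q`. A `k`-tuple `(v₁, …, vₖ)` of vectors of `T_qQ` is recorded as the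
linear map `ℝᵏ → T_qQ` that sends the `α`-th vector of the standard basis to `v_α`. -/
abbrev TanFibre (q : Q) : Type _ :=
  Bundle.Trivial Q (Fin k → ℝ) q →L[ℝ] TangentSpace 𝓘(ℝ, E) q

/-- The fibre of `(T¹ₖ)*Q` at `q`. A `k`-tuple `(p¹, …, pᵏ)` of covectors at `q` is recorded as the
linear map `T_qQ → ℝᵏ` whose `α`-th component is `p^α`. -/
abbrev CotanFibre (q : Q) : Type _ :=
  TangentSpace 𝓘(ℝ, E) q →L[ℝ] Bundle.Trivial Q (Fin k → ℝ) q

/-- The `k`-tangent bundle `T¹ₖQ = TQ ⊕ ⋯ ⊕ TQ`. -/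
abbrev KTan : Type _ :=
  Bundle.TotalSpace ((Fin k → ℝ) →L[ℝ] E) (TanFibre k E Q)

/-- The `k`-cotangent bundle `(T¹ₖ)*Q = T*Q ⊕ ⋯ ⊕ T*Q`. -/
abbrev KCotan : Type _ :=
  Bundle.TotalSpace (E →L[ℝ] (Fin k → ℝ)) (CotanFibre k E Q)

/-- The model with corners of `T¹ₖQ`. -/
abbrev modelTan := (𝓘(ℝ, E)).prod 𝓘(ℝ, (Fin k → ℝ) →L[ℝ] E)

/-- The model with corners of `(T¹ₖ)*Q`. -/
abbrev modelCotan := (𝓘(ℝ, E)).prod 𝓘(ℝ, E →L[ℝ] (Fin k → ℝ))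

end Bundles

/-! ### Lagrangian systems on `T¹ₖQ` -/

section Lagrangian

variable {k : ℕ} {E : Type*} [NormedAddCommGroup E] [NormedSpace ℝ E]
  {Q : Type*} [TopologicalSpace Q] [ChartedSpace E Q] [IsManifold 𝓘(ℝ, E) ∞ Q]

/-- A tangent vector of `T¹ₖQ` at `x`. -/
abbrev TanVec (x : KTan k E Q) : Type _ := TangentSpace (modelTan k E) x

/-- A (not necessarily smooth) vector field on `T¹ₖQ`. -/
abbrev VField (k : ℕ) (E : Type*) [NormedAddCommGroup E] [NormedSpace ℝ E]
    (Q : Type*) [TopologicalSpace Q] [ChartedSpace E Q] [IsManifold 𝓘(ℝ, E) ∞ Q] : Type _ :=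
  ∀ x : KTan k E Q, TanVec x

/-- The `k`-tuple `(0, …, w, …, 0)` with the vector `w` in the `α`-th place, as a linear map
`ℝᵏ → E`, depending linearly on `w`. -/
def slot (α : Fin k) : E →L[ℝ] ((Fin k → ℝ) →L[ℝ] E) :=
  ContinuousLinearMap.smulRightL ℝ (Fin k → ℝ) E (ContinuousLinearMap.proj α)

/-- The inclusion of the fibre of `T¹ₖQ` at `q` (the tangent spaces of `Q` are copies of `E`). -/
def fibreIncl (q : Q) (w : (Fin k → ℝ) →L[ℝ] E) : KTan k E Q := ⟨q, w⟩

/-- The vector part `(v₁, …, vₖ)` of the point `(q; v₁, …, vₖ)` of `T¹ₖQ`. -/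
def fibrePart (x : KTan k E Q) : (Fin k → ℝ) →L[ℝ] E := x.snd

/-- The vertical `α`-lift of tangent vectors of `Q` at the base point of `x` to `T_x(T¹ₖQ)`:
the derivative at `t = 0` of `t ↦ (q; v₁, …, v_α + t w, …, vₖ)`. -/
def vertLift (α : Fin k) (x : KTan k E Q) : TangentSpace 𝓘(ℝ, E) x.proj →L[ℝ] TanVec x :=
  (mfderiv 𝓘(ℝ, (Fin k → ℝ) →L[ℝ] E) (modelTan k E) (fibreIncl x.proj) (fibrePart x)).comp (slot (E := E) α)

/-- The derivative at `x` of the projection `π : T¹ₖQ → Q`. -/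
def dproj (x : KTan k E Q) : TanVec x →L[ℝ] TangentSpace 𝓘(ℝ, E) x.proj :=
  mfderiv (modelTan k E) 𝓘(ℝ, E) (fun y : KTan k E Q => y.proj) x

/-- The vertical endomorphism `J^α` of `T¹ₖQ`. -/
def vertEndo (α : Fin k) (x : KTan k E Q) : TanVec x →L[ℝ] TanVec x :=
  (vertLift α x).comp (dproj x)

/-- The component `v_α` of the point `(q; v₁, …, vₖ)` of `T¹ₖQ`. -/
def velocity (α : Fin k) (x : KTan k E Q) : TangentSpace 𝓘(ℝ, E) x.proj :=
  x.snd (Pi.single α (1 : ℝ))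

/-- The Liouville vector field `Δ` of `T¹ₖQ`. -/
def liouville (x : KTan k E Q) : TanVec x := ∑ α, vertLift α x (velocity α x)

/-- The differential of a function on `T¹ₖQ`. -/
def diff (f : KTan k E Q → ℝ) (x : KTan k E Q) : TanVec x →L[ℝ] ℝ :=
  mvfderiv (modelTan k E) f x

variable (L : KTan k E Q → ℝ)

/-- The Cartan 1-form `θ_L^α = (J^α)^* dL`. -/
def cartanOne (α : Fin k) (x : KTan k E Q) : TanVec x →L[ℝ] ℝ :=
  (diff L x).comp (vertEndo α x)

/-- The Cartan 2-form `ω_L^α = - dθ_L^α`. -/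
def cartanTwo (α : Fin k) (x : KTan k E Q) (u w : TanVec x) : ℝ :=
  - extDerivForm (modelTan k E) (cartanOne L α) x u w

/-- The Lagrangian energy `E_L = Δ(L) - L`. -/
def energy (x : KTan k E Q) : ℝ := diff L x (liouville x) - L x

/-- The 1-form `Ω_L(X) = ∑_α i(X_α) ω_L^α`, evaluated at `x` on `w`. -/
def omega (X : Fin k → VField k E Q) (x : KTan k E Q) (w : TanVec x) : ℝ :=
  ∑ α, cartanTwo L α x (X α x) w

/-- `X = (X₁, …, Xₖ)` is a smooth `k`-vector field on `T¹ₖQ`. -/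
def IsKVectorField (X : Fin k → VField k E Q) : Prop :=
  ∀ α, IsSmoothVectorField (modelTan k E) (X α)

/-- `X` is a smooth `k`-vector field on `T¹ₖQ` that solves the `k`-symplectic Lagrangian equation
`∑_α i(X_α) ω_L^α = dE_L` at the points of `S`. -/
def IsLagrangianOn (S : Set (KTan k E Q)) (X : Fin k → VField k E Q) : Prop :=
  IsKVectorField X ∧ ∀ x ∈ S, ∀ w : TanVec x, omega L X x w = diff (energy L) x w

/-- `V` is a smooth `π`-vertical `k`-vector field on `T¹ₖQ` with `Ω_L(V) = 0`. -/
def IsVerticalKer (V : Fin k → VField k E Q) : Prop :=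
  IsKVectorField V ∧ (∀ α x, dproj x (V α x) = 0) ∧ ∀ x (w : TanVec x), omega L V x w = 0

/-- The set `[𝔛ᵏ(T¹ₖQ)]^⊥` of smooth vector fields `Z` with `Ω_L(Y)(Z) = 0` for every smooth
`k`-vector field `Y`. -/
def annihilator : Set (VField k E Q) :=
  {Z | IsSmoothVectorField (modelTan k E) Z ∧
    ∀ Y : Fin k → VField k E Q, IsKVectorField Y → ∀ x, omega L Y x (Z x) = 0}

/-- The set `P₁` of the points `x` at which `dE_L` lies in the image of `Ω_L`. -/
def constraintP1 : Set (KTan k E Q) :=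
  {x | ∃ u : Fin k → TanVec x, ∀ w : TanVec x,
    ∑ α, cartanTwo L α x (u α) w = diff (energy L) x w}

/-- The first generation dynamical constraint `ζ₁^(Z) = i(Z) dE_L`. -/
def zeta1 (Z : VField k E Q) (x : KTan k E Q) : ℝ := diff (energy L) x (Z x)

/-- The function `W_α(ζ₁^(Z))`. For `W = X + V`, with `X` a Lagrangian `k`-vector field on `P₁` and
`V` a vertical `k`-vector field in the kernel of `Ω_L`, these functions are the second generation
dynamical constraints `ζ₂^(Z)`. -/
def zeta2 (W : Fin k → VField k E Q) (Z : VField k E Q) (α : Fin k) (x : KTan k E Q) : ℝ :=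
  diff (zeta1 L Z) x (W α x)

/-- The points of `P₁` where the functions `W_α(ζ₁^(Z))`, for `1 ≤ α ≤ k` and `Z ∈ 𝒵`, vanish. -/
def zeroLocus (W : Fin k → VField k E Q) (𝒵 : Set (VField k E Q)) : Set (KTan k E Q) :=
  {x ∈ constraintP1 L | ∀ Z ∈ 𝒵, ∀ α, zeta2 L W Z α x = 0}

/-- The set `P₂` of the points of `P₁` at which some Lagrangian `k`-vector field on `P₁` is tangent
to `P₁`, tangency being expressed by means of the constraints `ζ₁^(Z)` of `P₁`. -/
def constraintP2 : Set (KTan k E Q) :=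
  {x ∈ constraintP1 L | ∃ W, IsLagrangianOn L (constraintP1 L) W ∧
    ∀ Z ∈ annihilator L, ∀ α, zeta2 L W Z α x = 0}

/-! ### The Legendre map and projectability -/

/-- The Legendre map `FL : T¹ₖQ → (T¹ₖ)*Q`; the `α`-th component of `FL(q; v₁, …, vₖ)` sends `u` to
the derivative at `s = 0` of `L(q; v₁, …, v_α + s u, …, vₖ)`. -/
def legendre (x : KTan k E Q) : KCotan k E Q :=
  ⟨x.proj, ContinuousLinearMap.pi fun α =>
    (fderiv ℝ (fun w => L (fibreIncl x.proj w)) (fibrePart x)).comp (slot (E := E) α)⟩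

/-- The image `P₀` of the Legendre map. -/
abbrev imageP0 : Type _ := Set.range (legendre L)

/-- The Legendre map, as a map onto its image. -/
def legendre0 (x : KTan k E Q) : imageP0 L := ⟨legendre L x, x, rfl⟩

variable (d : ℕ) [ChartedSpace (EuclideanSpace ℝ (Fin d)) (imageP0 L)]

/-- `L` is almost-regular: the image `P₀` of the Legendre map, with the given smooth manifold
structure, is a closed submanifold of `(T¹ₖ)*Q`, the Legendre map is a submersion onto `P₀`, and
its fibres are connected. -/
structure IsAlmostRegular : Prop where
  smooth : ContMDiff (modelTan k E) 𝓘(ℝ) ∞ L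
  closed : IsClosed (Set.range (legendre L))
  submanifold : Manifold.IsSmoothEmbedding (𝓡 d) (modelCotan k E) ∞
    (Subtype.val : imageP0 L → KCotan k E Q)
  submersion : Manifold.IsSubmersion (modelTan k E) (𝓡 d) ∞ (legendre0 L)
  connected : ∀ p : imageP0 L, IsConnected (legendre0 L ⁻¹' {p})

/-- A function on `T¹ₖQ` is projectable by the Legendre map if it is the pull-back of a smooth
function on `P₀`. -/
def IsProjFun (f : KTan k E Q → ℝ) : Prop :=
  ∃ g : imageP0 L → ℝ, ContMDiff (𝓡 d) 𝓘(ℝ) ∞ g ∧ ∀ x, f x = g (legendre0 L x)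

/-- A vector field on `T¹ₖQ` is projectable by the Legendre map if it is related by the Legendre map
to a smooth vector field on `P₀`. -/
def IsProjField [IsManifold (𝓡 d) ∞ (imageP0 L)] (Z : VField k E Q) : Prop :=
  ∃ Z₀ : ∀ p : imageP0 L, TangentSpace (𝓡 d) p, IsSmoothVectorField (𝓡 d) Z₀ ∧
    ∀ x, mfderiv (modelTan k E) (𝓡 d) (legendre0 L) x (Z x) = Z₀ (legendre0 L x)

/-- The projectable vector fields in `[𝔛ᵏ(T¹ₖQ)]^⊥`. -/
def projAnnihilator [IsManifold (𝓡 d) ∞ (imageP0 L)] : Set (VField k E Q) :=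
  {Z ∈ annihilator L | IsProjField L d Z}

end Lagrangian

end KSymp

end

/-! The Legendre map, regarded as a map `f` onto `P₀`, is a surjective submersion, and all the data
of the Lagrangian equation come from `P₀`. Since `f` covers the identity of `Q`, the Cartan form
`θ_L^α` is the pull-back of the tautological form `p^α_i dq^i` restricted to `P₀`
(`IsAlmostRegular.cartanOne_eq`). Along a curve in a fibre of `f` the momenta are constant, so `E_L
= Σ p^α(v_α) - L` has zero derivative; the fibres are connected, hence `E_L = h ∘ f`
(`IsAlmostRegular.energy_eq`), with `h` smooth because `f` has local sections.

The rest concerns a surjective submersion `f : M → N` with 1-forms and a function pulled back from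
`N`. Because `df` is surjective, `w` solves the equation at `x` exactly when `df(w)` solves it at `f
x` (`solves_comp_iff`).

The decisive point is `mvfderiv_contraction_eq_zero`: at a point `x` of `P₁`, the differential of
`ζ₁^(Z)` depends only on `Z x`. Indeed, let `Y` lie in the kernel with `Y x = 0`, and let `u` solve
the equation at `x`. Extending `u` with constant coefficients in a chart, `de(Y) = (de + Σ i(u_α)
dΘ^α)(Y)` near `x`, a product of two factors that both vanish at `x`. So `Z` may be replaced by any
kernel field with the same value at `x`; a projectable one arises by pushing `Z` forward along a
local section, extending over `N`, and lifting back (`exists_projectable_inKernel`).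

Solutions are made projectable in the same way: push forward along local sections of `f`, glue on
`N`, lift to `M`. Gluing works because being a solution and being tangent are convex conditions on
the tuple of vectors (`exists_projectable_solution`). The tangency set is a union of fibres, so
local sections over its image stay inside it (`exists_projectable_solution_on`). -/

namespace KSymp

open Set Filter Topology

/-! ### Differential 1-forms, pull-back and exterior derivative in charts. -/

section Forms

variable {E : Type*} [NormedAddCommGroup E] [NormedSpace ℝ E]
  {H : Type*} [TopologicalSpace H] (J : ModelWithCorners ℝ E H)
  {M : Type*} [TopologicalSpace M] [ChartedSpace H M]
  {E' : Type*} [NormedAddCommGroup E'] [NormedSpace ℝ E']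
  {H' : Type*} [TopologicalSpace H'] (J' : ModelWithCorners ℝ E' H')
  {M' : Type*} [TopologicalSpace M'] [ChartedSpace H' M']

/-- The expression of a differential 1-form in the preferred chart at `c`, as a map into the dual
of the model space. -/
noncomputable def covectorInChart (θ : ∀ x : M, TangentSpace J x →L[ℝ] ℝ) (c : M) (y : E) :
    E →L[ℝ] ℝ :=
  (θ ((extChartAt J c).symm y)).comp (mfderiv 𝓘(ℝ, E) J (extChartAt J c).symm y)

lemma formInChart_eq (θ : ∀ x : M, TangentSpace J x →L[ℝ] ℝ) (c : M) :
    formInChart J θ c = fun y =>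
      ContinuousAlternatingMap.ofSubsingletonLIE (𝕜 := ℝ) (E := E) (F := ℝ) (0 : Fin 1)
        (covectorInChart J θ c y) := rfl

/-- A differential 1-form is smooth if it is smooth in every preferred chart. -/
def IsSmoothForm (θ : ∀ x : M, TangentSpace J x →L[ℝ] ℝ) : Prop :=
  ∀ c, ContDiffOn ℝ ∞ (covectorInChart J θ c) (extChartAt J c).target

/-- The pull-back of a differential 1-form by a map. -/
noncomputable def pullbackForm (f : M → M') (θ : ∀ x : M', TangentSpace J' x →L[ℝ] ℝ) (x : M) :
    TangentSpace J x →L[ℝ] ℝ :=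
  (θ (f x)).comp (mfderiv J J' f x)

variable {J J'}

lemma contDiffAt_formInChart [J.Boundaryless] {θ : ∀ x : M, TangentSpace J x →L[ℝ] ℝ}
    (hθ : IsSmoothForm J θ) {c : M} {y : E} (hy : y ∈ (extChartAt J c).target) :
    ContDiffAt ℝ ∞ (formInChart J θ c) y := by
  rw [formInChart_eq]
  exact (ContinuousAlternatingMap.ofSubsingletonLIE (𝕜 := ℝ) (E := E) (F := ℝ)
    (0 : Fin 1)).contDiff.contDiffAt.comp y
    ((hθ c).contDiffAt ((isOpen_extChartAt_target c).mem_nhds hy))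

lemma mdifferentiableAt_extChartAt_symm [J.Boundaryless] [IsManifold J 1 M] {c : M} {y : E}
    (hy : y ∈ (extChartAt J c).target) :
    MDifferentiableAt 𝓘(ℝ, E) J (extChartAt J c).symm y := by
  have := mdifferentiableWithinAt_extChartAt_symm (I := J) hy
  rwa [J.range_eq_univ, mdifferentiableWithinAt_univ] at this

lemma mfderiv_extChartAt_symm_comp [J.Boundaryless] [IsManifold J 1 M] {c x : M}
    (hx : x ∈ (chartAt H c).source) (v : TangentSpace J x) :
    (mfderiv 𝓘(ℝ, E) J (extChartAt J c).symm (extChartAt J c x)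
      (mfderiv J 𝓘(ℝ, E) (extChartAt J c) x v) : E) = v := by
  have := mfderivWithin_extChartAt_symm_comp_mfderiv_extChartAt' (I := J) (x := c) (y := x)
    (by rwa [extChartAt_source])
  rw [J.range_eq_univ, mfderivWithin_univ] at this
  exact congrArg (fun l : E →L[ℝ] E => l v) this

lemma mfderiv_extChartAt_comp_symm [J.Boundaryless] [IsManifold J 1 M] {c : M} {y : E}
    (hy : y ∈ (extChartAt J c).target) (v : E) :
    (mfderiv J 𝓘(ℝ, E) (extChartAt J c) ((extChartAt J c).symm y)
      (mfderiv 𝓘(ℝ, E) J (extChartAt J c).symm y v) : E) = v := by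
  have := mfderiv_extChartAt_comp_mfderivWithin_extChartAt_symm (I := J) (x := c) hy
  rw [J.range_eq_univ, mfderivWithin_univ] at this
  exact congrArg (fun l : E →L[ℝ] E => l v) this

lemma covectorInChart_pullback [J.Boundaryless] [J'.Boundaryless] [IsManifold J 1 M]
    [IsManifold J' 1 M'] {f : M → M'} (θ : ∀ x : M', TangentSpace J' x →L[ℝ] ℝ) {c : M} {c' : M'}
    {y : E} (hy : y ∈ (extChartAt J c).target)
    (hf : MDifferentiableAt J J' f ((extChartAt J c).symm y))
    (hy' : f ((extChartAt J c).symm y) ∈ (chartAt H' c').source) :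
    covectorInChart J (pullbackForm J J' f θ) c y =
      (covectorInChart J' θ c' (extChartAt J' c' (f ((extChartAt J c).symm y)))).comp
        (fderiv ℝ (extChartAt J' c' ∘ f ∘ (extChartAt J c).symm) y) := by
  set z := f ((extChartAt J c).symm y) with hz
  have h1 := mdifferentiableAt_extChartAt_symm (J := J) hy
  have h3 := mdifferentiableAt_extChartAt (I := J') hy'
  have hF : fderiv ℝ (extChartAt J' c' ∘ f ∘ (extChartAt J c).symm) y =
      (mfderiv J' 𝓘(ℝ, E') (extChartAt J' c') z).comp
        ((mfderiv J J' f ((extChartAt J c).symm y)).comp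
          (mfderiv 𝓘(ℝ, E) J (extChartAt J c).symm y)) := by
    rw [← mfderiv_eq_fderiv, mfderiv_comp y h3 (hf.comp y h1), mfderiv_comp y hf h1]
    rfl
  -- All tangent spaces are copies of the model space, so values at propositionally equal points can
  -- be compared in that space. The same transport device recurs below.
  have key : ∀ w, w = z → (θ w : E' →L[ℝ] ℝ) = (θ z : E' →L[ℝ] ℝ) := by rintro _ rfl; rfl
  ext v
  rw [hF]
  have hs : z ∈ (extChartAt J' c').source := by rwa [extChartAt_source]
  have e1 := mfderiv_extChartAt_symm_comp (J := J') hy'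
    (mfderiv J J' f ((extChartAt J c).symm y) (mfderiv 𝓘(ℝ, E) J (extChartAt J c).symm y v))
  have e2 := key _ ((extChartAt J' c').left_inv hs)
  change (θ z : E' →L[ℝ] ℝ) _ = (θ _ : E' →L[ℝ] ℝ) _
  rw [e2]
  exact congrArg (θ z : E' →L[ℝ] ℝ) e1.symm

lemma contDiffAt_writtenInCharts [J.Boundaryless] [IsManifold J ∞ M] [IsManifold J' ∞ M']
    {f : M → M'} {c : M} {c' : M'} {y : E} (hy : y ∈ (extChartAt J c).target)
    (hf : ContMDiffAt J J' ∞ f ((extChartAt J c).symm y))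
    (hy' : f ((extChartAt J c).symm y) ∈ (chartAt H' c').source) :
    ContDiffAt ℝ ∞ (extChartAt J' c' ∘ f ∘ (extChartAt J c).symm) y := by
  rw [← contMDiffAt_iff_contDiffAt]
  have h1 : ContMDiffAt 𝓘(ℝ, E) J ∞ (extChartAt J c).symm y :=
    (contMDiffOn_extChartAt_symm c).contMDiffAt ((isOpen_extChartAt_target c).mem_nhds hy)
  exact (contMDiffAt_extChartAt' hy').comp y (hf.comp y h1)

lemma IsSmoothForm.pullback [J.Boundaryless] [J'.Boundaryless] [IsManifold J ∞ M]
    [IsManifold J' ∞ M'] {f : M → M'} {θ : ∀ x : M', TangentSpace J' x →L[ℝ] ℝ}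
    (hθ : IsSmoothForm J' θ) (hf : ContMDiff J J' ∞ f) :
    IsSmoothForm J (pullbackForm J J' f θ) := by
  have : IsManifold J 1 M := .of_le (n := ∞) (by simp)
  have : IsManifold J' 1 M' := .of_le (n := ∞) (by simp)
  intro c y hy
  refine ContDiffAt.contDiffWithinAt ?_
  set c' := f ((extChartAt J c).symm y) with hc'
  have hs : c' ∈ (chartAt H' c').source := mem_chart_source H' c'
  have hF := contDiffAt_writtenInCharts hy hf.contMDiffAt hs
  have ev : ∀ᶠ y' in 𝓝 y, y' ∈ (extChartAt J c).target ∧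
      f ((extChartAt J c).symm y') ∈ (chartAt H' c').source :=
    Filter.Eventually.and ((isOpen_extChartAt_target c).mem_nhds hy)
      ((hf.continuous.continuousAt.comp (continuousAt_extChartAt_symm'' hy)).eventually
        ((chartAt H' c').open_source.mem_nhds hs))
  refine ContDiffAt.congr_of_eventuallyEq ?_
    (ev.mono fun y' h => covectorInChart_pullback θ h.1 (hf.mdifferentiableAt (by simp)) h.2)
  have h3 : ContDiffAt ℝ ∞ (covectorInChart J' θ c')
      ((extChartAt J' c' ∘ f ∘ (extChartAt J c).symm) y) :=
    (hθ c').contDiffAt ((isOpen_extChartAt_target c').mem_nhds (mem_extChartAt_target c'))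
  exact (h3.comp y hF).clm_comp (hF.fderiv_right (by simp))

/-- In charts this is naturality of `d` on vector spaces for the local expression `F` of `f`. The
charts `c` and `c'` are arbitrary, so that `f = id` yields independence of the chart. -/
lemma extDeriv_formInChart_pullback [J.Boundaryless] [J'.Boundaryless] [IsManifold J ∞ M]
    [IsManifold J' ∞ M'] {f : M → M'} {θ : ∀ x : M', TangentSpace J' x →L[ℝ] ℝ}
    (hθ : IsSmoothForm J' θ) (hf : ContMDiff J J' ∞ f) {c x : M} {c' : M'}
    (hx : x ∈ (chartAt H c).source) (hx' : f x ∈ (chartAt H' c').source)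
    (u w : TangentSpace J x) :
    extDeriv (formInChart J (pullbackForm J J' f θ) c) (extChartAt J c x)
      ![mfderiv J 𝓘(ℝ, E) (extChartAt J c) x u, mfderiv J 𝓘(ℝ, E) (extChartAt J c) x w] =
    extDeriv (formInChart J' θ c') (extChartAt J' c' (f x))
      ![mfderiv J' 𝓘(ℝ, E') (extChartAt J' c') (f x) (mfderiv J J' f x u),
        mfderiv J' 𝓘(ℝ, E') (extChartAt J' c') (f x) (mfderiv J J' f x w)] := by
  have : IsManifold J 1 M := .of_le (n := ∞) (by simp)
  have : IsManifold J' 1 M' := .of_le (n := ∞) (by simp)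
  have hxs : x ∈ (extChartAt J c).source := by rwa [extChartAt_source]
  have hxs' : f x ∈ (extChartAt J' c').source := by rwa [extChartAt_source]
  have hinv : (extChartAt J c).symm (extChartAt J c x) = x := (extChartAt J c).left_inv hxs
  set F := extChartAt J' c' ∘ f ∘ (extChartAt J c).symm with hF
  set y := extChartAt J c x with hy0
  have hy : y ∈ (extChartAt J c).target := (extChartAt J c).map_source hxs
  have hFy : F y = extChartAt J' c' (f x) := by
    rw [hF, Function.comp_apply, Function.comp_apply, hinv]
  have hFs : ContDiffAt ℝ ∞ F y := contDiffAt_writtenInCharts hy hf.contMDiffAt (by rwa [hinv])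
  have ev : ∀ᶠ y' in 𝓝 y, formInChart J (pullbackForm J J' f θ) c y' =
      (formInChart J' θ c' (F y')).compContinuousLinearMap (fderiv ℝ F y') := by
    have hcont : ContinuousAt (f ∘ (extChartAt J c).symm) y :=
      (hf.continuous.continuousAt).comp (continuousAt_extChartAt_symm'' hy)
    filter_upwards [(isOpen_extChartAt_target c).mem_nhds hy, hcont.eventually
      ((chartAt H' c').open_source.mem_nhds (by rwa [Function.comp_apply, hinv]))] with y' h1 h2
    have := covectorInChart_pullback θ h1 (hf.mdifferentiableAt (by simp)) h2
    rw [formInChart_eq, formInChart_eq]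
    simp only [this]
    rfl
  rw [Filter.EventuallyEq.extDeriv_eq ev, extDeriv_pullback (r := 2) _ (hFs.of_le (by norm_cast))
    (by simp), hFy]
  · have hD : ∀ v : TangentSpace J x, fderiv ℝ F y (mfderiv J 𝓘(ℝ, E) (extChartAt J c) x v) =
        mfderiv J' 𝓘(ℝ, E') (extChartAt J' c') (f x) (mfderiv J J' f x v) := by
      intro v
      have h1 := mdifferentiableAt_extChartAt_symm (J := J) hy
      have h2 : MDifferentiableAt J J' f ((extChartAt J c).symm y) :=
        hf.mdifferentiableAt (by simp)
      have h3 : MDifferentiableAt J' 𝓘(ℝ, E') (extChartAt J' c') (f ((extChartAt J c).symm y)) :=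
        mdifferentiableAt_extChartAt (by rwa [hinv])
      rw [← mfderiv_eq_fderiv, hF, mfderiv_comp y h3 (h2.comp y h1), mfderiv_comp y h2 h1]
      have e := mfderiv_extChartAt_symm_comp (J := J) hx v
      have key : ∀ z, z = x → ∀ a : E, a = v →
          (mfderiv J' 𝓘(ℝ, E') (extChartAt J' c') (f z) (mfderiv J J' f z a : E') : E') =
          mfderiv J' 𝓘(ℝ, E') (extChartAt J' c') (f x) (mfderiv J J' f x v) := by
        rintro _ rfl _ rfl; rfl
      exact key _ hinv _ e
    rw [ContinuousAlternatingMap.compContinuousLinearMap_apply]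
    congr 1
    ext i
    fin_cases i
    · exact hD u
    · exact hD w
  · rw [hFy]
    exact (contDiffAt_formInChart hθ ((extChartAt J' c').map_source hxs')).differentiableAt (by simp)

lemma extDerivForm_pullback [J.Boundaryless] [J'.Boundaryless] [IsManifold J ∞ M]
    [IsManifold J' ∞ M'] {f : M → M'} {θ : ∀ x : M', TangentSpace J' x →L[ℝ] ℝ}
    (hθ : IsSmoothForm J' θ) (hf : ContMDiff J J' ∞ f) (x : M) (u w : TangentSpace J x) :
    extDerivForm J (pullbackForm J J' f θ) x u w =
      extDerivForm J' θ (f x) (mfderiv J J' f x u) (mfderiv J J' f x w) :=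
  extDeriv_formInChart_pullback hθ hf (mem_chart_source H x) (mem_chart_source H' (f x)) u w

/-- Naturality for the identity map. It allows one fixed chart to compute `dθ` at all points near
its centre, as differentiation of contractions requires. -/
lemma extDerivForm_eq_of_mem_chart [J.Boundaryless] [IsManifold J ∞ M]
    {θ : ∀ x : M, TangentSpace J x →L[ℝ] ℝ} (hθ : IsSmoothForm J θ) {c x : M}
    (hx : x ∈ (chartAt H c).source) (u w : TangentSpace J x) :
    extDerivForm J θ x u w = extDeriv (formInChart J θ c) (extChartAt J c x)
      ![mfderiv J 𝓘(ℝ, E) (extChartAt J c) x u, mfderiv J 𝓘(ℝ, E) (extChartAt J c) x w] := by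
  have h := extDeriv_formInChart_pullback (f := id) hθ contMDiff_id (mem_chart_source H x) hx u w
  have hid : pullbackForm J J id θ = θ := by
    funext x
    simp only [pullbackForm, mfderiv_id]
    rfl
  rw [hid, mfderiv_id] at h
  exact h

lemma extDerivForm_add_left (θ : ∀ x : M, TangentSpace J x →L[ℝ] ℝ) (x : M)
    (u u' w : TangentSpace J x) :
    extDerivForm J θ x (u + u') w = extDerivForm J θ x u w + extDerivForm J θ x u' w := by
  simp only [extDerivForm, map_add]
  exact (extDeriv (formInChart J θ x) (extChartAt J x x)).vecCons_add ![_] _ _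

lemma extDerivForm_smul_left (θ : ∀ x : M, TangentSpace J x →L[ℝ] ℝ) (x : M) (a : ℝ)
    (u w : TangentSpace J x) :
    extDerivForm J θ x (a • u) w = a * extDerivForm J θ x u w := by
  simp only [extDerivForm, map_smul]
  exact (extDeriv (formInChart J θ x) (extChartAt J x x)).vecCons_smul ![_] _ _

lemma extDerivForm_swap (θ : ∀ x : M, TangentSpace J x →L[ℝ] ℝ) (x : M)
    (u w : TangentSpace J x) :
    extDerivForm J θ x u w = - extDerivForm J θ x w u := by
  simp only [extDerivForm]
  have := (extDeriv (formInChart J θ x) (extChartAt J x x)).map_swap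
    ![mfderiv J 𝓘(ℝ, E) (extChartAt J x) x w, mfderiv J 𝓘(ℝ, E) (extChartAt J x) x u]
    (i := 0) (j := 1) (by simp)
  refine Eq.trans (congrArg (extDeriv (formInChart J θ x) (extChartAt J x x)) ?_) this
  ext i
  fin_cases i <;> rfl

end Forms

end KSymp

namespace KSymp

open Set Filter Topology Bundle

/-! ### Smooth vector fields and their gluing. -/

section VectorFields

variable {E : Type*} [NormedAddCommGroup E] [NormedSpace ℝ E]
  {H : Type*} [TopologicalSpace H] {J : ModelWithCorners ℝ E H}
  {M : Type*} [TopologicalSpace M] [ChartedSpace H M]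
  {E' : Type*} [NormedAddCommGroup E'] [NormedSpace ℝ E']
  {H' : Type*} [TopologicalSpace H'] {J' : ModelWithCorners ℝ E' H'}
  {M' : Type*} [TopologicalSpace M'] [ChartedSpace H' M']

lemma contMDiffOn_tangentMap_of_isOpen [IsManifold J 1 M] [IsManifold J' 1 M'] {f : M → M'}
    {U : Set M} (hU : IsOpen U) (hf : ContMDiffOn J J' ∞ f U) :
    ContMDiffOn J.tangent J'.tangent ∞ (tangentMap J J' f)
      (π E (TangentSpace J : M → Type _) ⁻¹' U) := by
  refine (hf.contMDiffOn_tangentMapWithin (m := ∞) (by simp) hU.uniqueMDiffOn).congr ?_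
  intro p hp
  simp only [tangentMap, tangentMapWithin]
  rw [mfderivWithin_of_isOpen hU hp]

lemma contMDiffOn_mk_tangentBundle_modelSpace {f v : M → E'} {U : Set M}
    (hf : ContMDiffOn J 𝓘(ℝ, E') ∞ f U) (hv : ContMDiffOn J 𝓘(ℝ, E') ∞ v U) :
    ContMDiffOn J 𝓘(ℝ, E').tangent ∞ (fun y => (⟨f y, v y⟩ : TangentBundle 𝓘(ℝ, E') E')) U := by
  intro y hy
  refine contMDiffWithinAt_totalSpace.2 ⟨hf y hy, ?_⟩
  convert! hv y hy with z
  simp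

/-- Gluing of local tuples of sections of the tangent bundle with values in convex sets. -/
lemma exists_smooth_tuple_of_local [FiniteDimensional ℝ E] [IsManifold J ∞ M] [SigmaCompactSpace M]
    [T2Space M] {k : ℕ} (t : ∀ x : M, Set (Fin k → TangentSpace J x)) (ht : ∀ x, Convex ℝ (t x))
    (hloc : ∀ x₀ : M, ∃ U ∈ 𝓝 x₀, ∃ s : Fin k → ∀ x : M, TangentSpace J x,
      (∀ α, ContMDiffOn J J.tangent ∞ (fun x => (⟨x, s α x⟩ : TangentBundle J M)) U) ∧
      ∀ y ∈ U, (fun α => s α y) ∈ t y) :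
    ∃ s : Fin k → ∀ x : M, TangentSpace J x,
      (∀ α, IsSmoothVectorField J (s α)) ∧ ∀ y, (fun α => s α y) ∈ t y := by
  choose W h_nhds s_loc s_smooth h_mem_t using hloc
  obtain ⟨ρ, hρU⟩ : ∃ ρ : SmoothPartitionOfUnity M J M univ,
      ρ.IsSubordinate (fun x => interior (W x)) :=
    SmoothPartitionOfUnity.exists_isSubordinate J isClosed_univ _ (fun x ↦ isOpen_interior)
      (fun x _ => mem_iUnion.2 ⟨x, mem_interior_iff_mem_nhds.2 (h_nhds x)⟩)
  have hfin : ∀ x, (Function.support fun j => ρ j x).Finite := fun x => ρ.locallyFinite.point_finite x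
  refine ⟨fun α x => ∑ᶠ j, ρ j x • s_loc j α x, fun α => ?_, fun x => ?_⟩
  · have h1 (j : M) : ContMDiff J J.tangent ∞
        (fun x => (⟨x, ρ j x • s_loc j α x⟩ : TangentBundle J M)) :=
      ContMDiffOn.smul_section_of_tsupport ((ρ j).contMDiff.contMDiffOn) isOpen_interior (hρU j)
        ((s_smooth j α).mono interior_subset)
    refine ContMDiff.finsum_section_of_locallyFinite ?_ h1
    refine ρ.locallyFinite.subset fun i x hx ↦ ?_
    exact left_ne_zero_of_smul hx
  -- The convex combination is taken in the product of the `k` tangent spaces with the same weights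
  -- in each component, since the condition `t` couples the components.
  · have h2 := (ht x).finsum_mem (w := fun j => ρ j x) (z := fun j α => s_loc j α x)
      (fun j => ρ.nonneg j x) (ρ.sum_eq_one (mem_univ x))
      (fun j hj => h_mem_t j x (interior_subset (hρU j (subset_closure hj))))
    convert h2 using 1
    funext α
    rw [finsum_apply]
    · rfl
    · exact (hfin x).subset fun j hj h0 => hj (by simp [h0])

lemma exists_smooth_vectorField_of_local [FiniteDimensional ℝ E] [IsManifold J ∞ M]
    [SigmaCompactSpace M] [T2Space M] (t : ∀ x : M, Set (TangentSpace J x))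
    (ht : ∀ x, Convex ℝ (t x))
    (hloc : ∀ x₀ : M, ∃ U ∈ 𝓝 x₀, ∃ s : ∀ x : M, TangentSpace J x,
      ContMDiffOn J J.tangent ∞ (fun x => (⟨x, s x⟩ : TangentBundle J M)) U ∧ ∀ y ∈ U, s y ∈ t y) :
    ∃ s : ∀ x : M, TangentSpace J x, IsSmoothVectorField J s ∧ ∀ y, s y ∈ t y := by
  obtain ⟨s, hs⟩ := exists_contMDiffSection_forall_mem_convex_of_local J (n := ⊤)
    (F_fiber := E) (fun x : M => TangentSpace J x) t ht hloc
  exact ⟨s, s.contMDiff, hs⟩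

/-- Convex gluing with the condition `{u}` at `x` and no condition elsewhere; the zero field serves
locally away from `x`. -/
lemma exists_smooth_vectorField_eq [FiniteDimensional ℝ E] [IsManifold J ∞ M]
    [SigmaCompactSpace M] [T2Space M] (x : M) (u : TangentSpace J x) :
    ∃ s : ∀ x : M, TangentSpace J x, IsSmoothVectorField J s ∧ s x = u := by
  obtain ⟨U, hU, hs⟩ := FiberBundle.exists_contMDiffOn_extend (k := ∞) J E u
  have conv : ∀ y : M, Convex ℝ {z : TangentSpace J y | ∀ h : y = x, z = h ▸ u} := by
    intro y a ha b hb c d _ _ hcd h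
    subst h
    have ha' : a = u := ha rfl
    have hb' : b = u := hb rfl
    rw [ha', hb', ← add_smul, hcd, one_smul]
  obtain ⟨s, h1, h2⟩ := exists_smooth_vectorField_of_local _ conv fun x₀ => by
    by_cases h : x₀ = x
    · subst h
      refine ⟨U, hU, _, hs, fun y hy h' => ?_⟩
      subst h'
      exact FiberBundle.extend_apply_self _ _
    · exact ⟨{x}ᶜ, isOpen_compl_singleton.mem_nhds h, 0, (contMDiff_zeroSection ℝ _).contMDiffOn,
        fun y hy h' => absurd h' hy⟩
  exact ⟨s, h1, h2 x rfl⟩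

lemma IsSmoothVectorField.sub [IsManifold J ∞ M] {Z Z' : ∀ x : M, TangentSpace J x}
    (h : IsSmoothVectorField J Z) (h' : IsSmoothVectorField J Z') :
    IsSmoothVectorField J (fun x => Z x - Z' x) :=
  ContMDiff.sub_section h h'

lemma IsSmoothVectorField.add [IsManifold J ∞ M] {Z Z' : ∀ x : M, TangentSpace J x}
    (h : IsSmoothVectorField J Z) (h' : IsSmoothVectorField J Z') :
    IsSmoothVectorField J (fun x => Z x + Z' x) :=
  ContMDiff.add_section h h'

/-- The derivative of a smooth function along a smooth vector field is smooth. -/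
lemma contMDiff_mvfderiv_apply [IsManifold J ∞ M] {e : M → ℝ} (he : ContMDiff J 𝓘(ℝ) ∞ e)
    {Z : ∀ x : M, TangentSpace J x} (hZ : IsSmoothVectorField J Z) :
    ContMDiff J 𝓘(ℝ) ∞ (fun x => mvfderiv J e x (Z x)) :=
  (contMDiff_snd_tangentBundle_modelSpace ℝ 𝓘(ℝ)).comp
    ((he.contMDiff_tangentMap (m := ∞) (by simp)).comp hZ)

lemma differentiableAt_vectorField_inChart [J.Boundaryless] [IsManifold J ∞ M]
    {Y : ∀ x : M, TangentSpace J x} (hY : IsSmoothVectorField J Y) (x : M) :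
    DifferentiableAt ℝ (fun z => (mfderiv J 𝓘(ℝ, E) (extChartAt J x) ((extChartAt J x).symm z)
      (Y ((extChartAt J x).symm z)) : E)) (extChartAt J x x) := by
  have h1 : ContMDiffOn J 𝓘(ℝ, E) ∞ (extChartAt J x) (chartAt H x).source :=
    contMDiffOn_extChartAt
  have h2 := contMDiffOn_tangentMap_of_isOpen (chartAt H x).open_source h1
  have h3 : ContMDiffAt 𝓘(ℝ, E) J ∞ (extChartAt J x).symm (extChartAt J x x) :=
    (contMDiffOn_extChartAt_symm x).contMDiffAt
      ((isOpen_extChartAt_target x).mem_nhds (mem_extChartAt_target x))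
  have h4 : ContMDiffAt J J.tangent ∞ (fun y => (⟨y, Y y⟩ : TangentBundle J M))
    ((extChartAt J x).symm (extChartAt J x x)) := hY.contMDiffAt
  have h5 := h4.comp _ h3
  have h6 := (contMDiff_snd_tangentBundle_modelSpace E 𝓘(ℝ, E) (n := ∞)).contMDiffAt.comp _
    (ContMDiffAt.comp (I' := J.tangent) (extChartAt J x x)
      (h2.contMDiffAt (x := ⟨(extChartAt J x).symm (extChartAt J x x), Y _⟩) (by
      refine ((chartAt H x).open_source.preimage (FiberBundle.continuous_proj E _)).mem_nhds ?_
      simp)) h5)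
  exact (contMDiffAt_iff_contDiffAt.1 h6).differentiableAt (by simp)

end VectorFields

end KSymp

namespace KSymp

open Set Filter Topology Bundle

/-! ### Submersions: local sections, curves in fibres, lifts of vector fields. -/

section Submersions

universe u

variable {E : Type u} [NormedAddCommGroup E] [NormedSpace ℝ E]
  {H : Type*} [TopologicalSpace H] {J : ModelWithCorners ℝ E H}
  {M : Type*} [TopologicalSpace M] [ChartedSpace H M]
  {E' : Type*} [NormedAddCommGroup E'] [NormedSpace ℝ E']
  {H' : Type*} [TopologicalSpace H'] {J' : ModelWithCorners ℝ E' H'}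
  {N : Type*} [TopologicalSpace N] [ChartedSpace H' N]

/-- Charts in which a map looks like a linear projection near a point. -/
structure SubmersionChart (J : ModelWithCorners ℝ E H) (J' : ModelWithCorners ℝ E' H')
    (f : M → N) (x : M) (F : Type u) [NormedAddCommGroup F] [NormedSpace ℝ F] where
  /-- The chart of the domain. -/
  dom : PartialEquiv M E
  /-- The chart of the codomain. -/
  cod : PartialEquiv N E'
  /-- The splitting of the model space. -/
  split : E ≃L[ℝ] (E' × F)
  open_dom_source : IsOpen dom.source
  open_dom_target : IsOpen dom.target
  open_cod_source : IsOpen cod.source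
  mem_source : x ∈ dom.source
  mapsTo : MapsTo f dom.source cod.source
  smooth_dom : ContMDiffOn J 𝓘(ℝ, E) ∞ dom dom.source
  smooth_dom_symm : ContMDiffOn 𝓘(ℝ, E) J ∞ dom.symm dom.target
  smooth_cod : ContMDiffOn J' 𝓘(ℝ, E') ∞ cod cod.source
  open_cod_target : IsOpen cod.target
  smooth_cod_symm : ContMDiffOn 𝓘(ℝ, E') J' ∞ cod.symm cod.target
  cod_apply : ∀ y ∈ dom.source, cod (f y) = (split (dom y)).1

lemma exists_submersionChart [J.Boundaryless] [J'.Boundaryless] {f : M → N} {x : M}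
    (h : Manifold.IsSubmersionAt J J' ∞ f x) :
    ∃ (F : Type u) (_ : NormedAddCommGroup F) (_ : NormedSpace ℝ F),
      Nonempty (SubmersionChart J J' f x F) := by
  refine ⟨h.complement, inferInstance, inferInstance, ⟨?_⟩⟩
  refine
    { dom := h.domChart.extend J
      cod := h.codChart.extend J'
      split := h.equiv
      open_dom_source := h.domChart.isOpen_extend_source
      open_dom_target := h.domChart.isOpen_extend_target
      open_cod_source := h.codChart.isOpen_extend_source
      open_cod_target := h.codChart.isOpen_extend_target
      mem_source := by
        rw [OpenPartialHomeomorph.extend_source]; exact h.mem_domChart_source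
      mapsTo := by
        simp only [OpenPartialHomeomorph.extend_source]
        exact h.source_subset_preimage_source
      smooth_dom := by
        rw [OpenPartialHomeomorph.extend_source]
        exact OpenPartialHomeomorph.contMDiffOn_extend h.domChart_mem_maximalAtlas
      smooth_dom_symm := by
        rw [OpenPartialHomeomorph.extend_target']
        exact contMDiffOn_extend_symm h.domChart_mem_maximalAtlas
      smooth_cod := by
        rw [OpenPartialHomeomorph.extend_source]
        exact OpenPartialHomeomorph.contMDiffOn_extend h.codChart_mem_maximalAtlas
      smooth_cod_symm := by
        rw [OpenPartialHomeomorph.extend_target']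
        exact contMDiffOn_extend_symm h.codChart_mem_maximalAtlas
      cod_apply := fun y hy => ?_ }
  have := h.writtenInCharts ((h.domChart.extend J).map_source hy)
  simpa only [Function.comp_apply, (h.domChart.extend J).left_inv hy] using this

namespace SubmersionChart

variable {F : Type u} [NormedAddCommGroup F] [NormedSpace ℝ F] {f : M → N} {x : M}

/-- In the adapted charts the section freezes the `F`-coordinate at its value at `x`, which makes it
pass through `x`. -/
lemma exists_local_section (c : SubmersionChart J J' f x F) :
    ∃ (σ : N → M) (U : Set N), IsOpen U ∧ f x ∈ U ∧ ContMDiffOn J' J ∞ σ U ∧ σ (f x) = x ∧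
      ∀ p ∈ U, f (σ p) = p := by
  have hx := c.mem_source
  let g : N → E := fun p => c.split.symm (c.cod p, (c.split (c.dom x)).2)
  have hg : ContMDiffOn J' 𝓘(ℝ, E) ∞ g c.cod.source :=
    (c.split.symm.contDiff.contMDiff).comp_contMDiffOn
      (c.smooth_cod.prodMk_space contMDiffOn_const)
  have hgx : g (f x) = c.dom x := by simp [g, c.cod_apply x hx]
  refine ⟨fun p => c.dom.symm (g p), c.cod.source ∩ g ⁻¹' c.dom.target,
    hg.continuousOn.isOpen_inter_preimage c.open_cod_source c.open_dom_target,
    ⟨c.mapsTo hx, ?_⟩, ?_, ?_, ?_⟩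
  · rw [mem_preimage, hgx]
    exact c.dom.map_source hx
  · exact c.smooth_dom_symm.comp (hg.mono inter_subset_left) inter_subset_right
  · exact (congrArg c.dom.symm hgx).trans (c.dom.left_inv hx)
  · intro p hp
    have h1 : c.dom.symm (g p) ∈ c.dom.source := c.dom.map_target hp.2
    refine c.cod.injOn (c.mapsTo h1) hp.1 ?_
    rw [c.cod_apply _ h1, c.dom.right_inv hp.2]
    simp [g]

/-- Points of a fibre that are close to each other can be joined by a smooth curve in the fibre. -/
lemma exists_curve_in_fibre (c : SubmersionChart J J' f x F) :
    ∃ U ∈ 𝓝 x, ∀ y ∈ U, f y = f x → ∃ γ : ℝ → M, γ 0 = x ∧ γ 1 = y ∧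
      ∀ t ∈ Icc (0 : ℝ) 1, ContMDiffAt 𝓘(ℝ) J ∞ γ t ∧ f (γ t) = f x := by
  have hx := c.mem_source
  obtain ⟨r, hr, hball⟩ := Metric.isOpen_iff.1 c.open_dom_target _ (c.dom.map_source hx)
  refine ⟨c.dom.source ∩ c.dom ⁻¹' Metric.ball (c.dom x) r,
    (c.smooth_dom.continuousOn.isOpen_inter_preimage c.open_dom_source
      Metric.isOpen_ball).mem_nhds ⟨hx, Metric.mem_ball_self hr⟩, fun y hy hfy => ?_⟩
  -- A straight segment in the chart: its endpoints have the same `E'`-coordinate, so this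
  -- coordinate is constant and the segment stays in the fibre.
  let g : ℝ → E := fun t => c.dom x + t • (c.dom y - c.dom x)
  have hg : ContDiff ℝ ∞ g := by fun_prop
  have hgt : ∀ t ∈ Icc (0 : ℝ) 1, g t ∈ c.dom.target := fun t ht =>
    hball ((convex_ball (c.dom x) r).add_smul_sub_mem (Metric.mem_ball_self hr) hy.2 ht)
  refine ⟨fun t => c.dom.symm (g t), ?_, ?_, fun t ht => ⟨?_, ?_⟩⟩
  · simp [g, c.dom.left_inv hx]
  · simp [g, c.dom.left_inv hy.1]
  · exact (c.smooth_dom_symm.contMDiffAt (c.open_dom_target.mem_nhds (hgt t ht))).comp t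
      hg.contMDiff.contMDiffAt
  · have h1 : c.dom.symm (g t) ∈ c.dom.source := c.dom.map_target (hgt t ht)
    refine c.cod.injOn (c.mapsTo h1) (c.mapsTo hx) ?_
    have h2 := congrArg c.cod hfy
    rw [c.cod_apply _ hx, c.cod_apply _ hy.1] at h2
    rw [c.cod_apply _ h1, c.dom.right_inv (hgt t ht), c.cod_apply _ hx]
    simp [g, h2]

lemma mfderiv_cod_comp (c : SubmersionChart J J' f x F) (hf : ContMDiff J J' ∞ f) {y : M}
    (hy : y ∈ c.dom.source)
    (v : TangentSpace J y) :
    (mfderiv J' 𝓘(ℝ, E') c.cod (f y) (mfderiv J J' f y v) : E') =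
      (c.split (mfderiv J 𝓘(ℝ, E) c.dom y v)).1 := by
  have h1 : MDifferentiableAt J 𝓘(ℝ, E) c.dom y :=
    (c.smooth_dom.contMDiffAt (c.open_dom_source.mem_nhds hy)).mdifferentiableAt (by simp)
  have h2 : MDifferentiableAt J' 𝓘(ℝ, E') c.cod (f y) :=
    (c.smooth_cod.contMDiffAt (c.open_cod_source.mem_nhds (c.mapsTo hy))).mdifferentiableAt
      (by simp)
  let p : E →L[ℝ] E' := (ContinuousLinearMap.fst ℝ E' F).comp (c.split : E →L[ℝ] (E' × F))
  have h3 : c.cod ∘ f =ᶠ[𝓝 y] p ∘ c.dom := by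
    filter_upwards [c.open_dom_source.mem_nhds hy] with z hz
    exact c.cod_apply z hz
  have h4 := h3.mfderiv_eq (I := J) (I' := 𝓘(ℝ, E'))
  rw [mfderiv_comp y h2 (hf.mdifferentiableAt (by simp)),
    mfderiv_comp (I' := 𝓘(ℝ, E)) y p.differentiableAt.mdifferentiableAt h1, mfderiv_eq_fderiv,
    p.fderiv] at h4
  exact congrArg (fun l : E →L[ℝ] E' => l v) h4

lemma mfderiv_symm_comp_dom (c : SubmersionChart J J' f x F) {y : M}
    (hy : y ∈ c.dom.source) (v : TangentSpace J y) :
    (mfderiv 𝓘(ℝ, E) J c.dom.symm (c.dom y) (mfderiv J 𝓘(ℝ, E) c.dom y v) : E) = v := by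
  have h1 : MDifferentiableAt J 𝓘(ℝ, E) c.dom y :=
    (c.smooth_dom.contMDiffAt (c.open_dom_source.mem_nhds hy)).mdifferentiableAt (by simp)
  have h2 : MDifferentiableAt 𝓘(ℝ, E) J c.dom.symm (c.dom y) :=
    (c.smooth_dom_symm.contMDiffAt (c.open_dom_target.mem_nhds
      (c.dom.map_source hy))).mdifferentiableAt (by simp)
  have h3 : c.dom.symm ∘ c.dom =ᶠ[𝓝 y] id := by
    filter_upwards [c.open_dom_source.mem_nhds hy] with z hz
    exact c.dom.left_inv hz
  have h4 := h3.mfderiv_eq (I := J) (I' := J)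
  rw [mfderiv_comp y h2 h1, mfderiv_id] at h4
  exact congrArg (fun l : E →L[ℝ] E => l v) h4

lemma mfderiv_dom_comp_symm (c : SubmersionChart J J' f x F) {y : M} (hy : y ∈ c.dom.source) (v : E) :
    (mfderiv J 𝓘(ℝ, E) c.dom y (mfderiv 𝓘(ℝ, E) J c.dom.symm (c.dom y) v : E) : E) = v := by
  have hy' := c.dom.map_source hy
  have h1 : MDifferentiableAt J 𝓘(ℝ, E) c.dom (c.dom.symm (c.dom y)) := by
    rw [c.dom.left_inv hy]
    exact (c.smooth_dom.contMDiffAt (c.open_dom_source.mem_nhds hy)).mdifferentiableAt (by simp)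
  have h2 : MDifferentiableAt 𝓘(ℝ, E) J c.dom.symm (c.dom y) :=
    (c.smooth_dom_symm.contMDiffAt (c.open_dom_target.mem_nhds hy')).mdifferentiableAt (by simp)
  have h3 : c.dom ∘ c.dom.symm =ᶠ[𝓝 (c.dom y)] id := by
    filter_upwards [c.open_dom_target.mem_nhds hy'] with z hz
    exact c.dom.right_inv hz
  have h4 := h3.mfderiv_eq (I := 𝓘(ℝ, E)) (I' := 𝓘(ℝ, E))
  rw [mfderiv_comp (I' := J) _ h1 h2, mfderiv_id] at h4
  have key : ∀ z, z = y → ∀ w : E, (mfderiv J 𝓘(ℝ, E) c.dom z w : E) =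
      (mfderiv J 𝓘(ℝ, E) c.dom y w : E) := by rintro _ rfl w; rfl
  refine (key _ (c.dom.left_inv hy) _).symm.trans ?_
  exact congrArg (fun l : E →L[ℝ] E => l v) h4

lemma mfderiv_cod_injective (c : SubmersionChart J J' f x F) {y : M} (hy : y ∈ c.dom.source) :
    Function.Injective (mfderiv J' 𝓘(ℝ, E') c.cod (f y)) := by
  have hy' := c.mapsTo hy
  have h1 : MDifferentiableAt J' 𝓘(ℝ, E') c.cod (f y) :=
    (c.smooth_cod.contMDiffAt (c.open_cod_source.mem_nhds hy')).mdifferentiableAt (by simp)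
  have h2 : MDifferentiableAt 𝓘(ℝ, E') J' c.cod.symm (c.cod (f y)) :=
    (c.smooth_cod_symm.contMDiffAt (c.open_cod_target.mem_nhds
      (c.cod.map_source hy'))).mdifferentiableAt (by simp)
  have h3 : c.cod.symm ∘ c.cod =ᶠ[𝓝 (f y)] id := by
    filter_upwards [c.open_cod_source.mem_nhds hy'] with z hz
    exact c.cod.left_inv hz
  have h4 := h3.mfderiv_eq (I := J') (I' := J')
  rw [mfderiv_comp _ h2 h1, mfderiv_id] at h4
  intro v w hvw
  have h5 := congrArg (fun l : E' →L[ℝ] E' => l v) h4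
  have h6 := congrArg (fun l : E' →L[ℝ] E' => l w) h4
  exact h5.symm.trans ((congrArg (mfderiv 𝓘(ℝ, E') J' c.cod.symm (c.cod (f y))) hvw).trans h6)

/-- Vector fields lift locally along a submersion, with a prescribed value at a point. -/
lemma exists_local_lift [IsManifold J ∞ M] [IsManifold J' ∞ N]
    (c : SubmersionChart J J' f x F) (hf : ContMDiff J J' ∞ f) {Z₀ : ∀ p : N, TangentSpace J' p}
    (hZ₀ : IsSmoothVectorField J' Z₀) (z : TangentSpace J x)
    (hz : mfderiv J J' f x z = Z₀ (f x)) :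
    ∃ U ∈ 𝓝 x, ∃ s : ∀ y : M, TangentSpace J y,
      ContMDiffOn J J.tangent ∞ (fun y => (⟨y, s y⟩ : TangentBundle J M)) U ∧
      (∀ y ∈ U, mfderiv J J' f y (s y) = Z₀ (f y)) ∧ s x = z := by
  have : IsManifold J 1 M := .of_le (n := ∞) (by simp)
  have : IsManifold J' 1 N := .of_le (n := ∞) (by simp)
  -- The `E'`-component of a lift is forced by `Z₀`; the free `F`-component is taken constant, equal
  -- to that of `z`.
  let a : F := (c.split (mfderiv J 𝓘(ℝ, E) c.dom x z)).2
  let v : M → E := fun y =>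
    c.split.symm ((mfderiv J' 𝓘(ℝ, E') c.cod (f y) (Z₀ (f y)) : E'), a)
  let s : ∀ y : M, TangentSpace J y := fun y =>
    (mfderiv 𝓘(ℝ, E) J c.dom.symm (c.dom y) (v y) : E)
  refine ⟨c.dom.source, c.open_dom_source.mem_nhds c.mem_source, s, ?_, ?_, ?_⟩
  · have h1 : ContMDiffOn J 𝓘(ℝ, E') ∞
        (fun y => (mfderiv J' 𝓘(ℝ, E') c.cod (f y) (Z₀ (f y)) : E')) c.dom.source := by
      have h2 := contMDiffOn_tangentMap_of_isOpen c.open_cod_source c.smooth_cod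
      have h3 : ContMDiff J J'.tangent ∞ (fun y => (⟨f y, Z₀ (f y)⟩ : TangentBundle J' N)) :=
        ContMDiff.comp (I' := J') hZ₀ hf
      exact (contMDiff_snd_tangentBundle_modelSpace E' 𝓘(ℝ, E')).comp_contMDiffOn
        (h2.comp h3.contMDiffOn fun y hy => c.mapsTo hy)
    have h2 : ContMDiffOn J 𝓘(ℝ, E) ∞ v c.dom.source :=
      (c.split.symm.contDiff.contMDiff).comp_contMDiffOn (h1.prodMk_space contMDiffOn_const)
    have h3 := (contMDiffOn_tangentMap_of_isOpen c.open_dom_target c.smooth_dom_symm).comp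
      (contMDiffOn_mk_tangentBundle_modelSpace c.smooth_dom h2) fun y hy => c.dom.map_source hy
    refine h3.congr fun y hy => ?_
    exact congrArg (fun q => (⟨q, s y⟩ : TangentBundle J M)) (c.dom.left_inv hy).symm
  · intro y hy
    apply c.mfderiv_cod_injective hy
    refine (c.mfderiv_cod_comp hf hy (s y)).trans ?_
    have := c.mfderiv_dom_comp_symm hy (v y)
    refine (congrArg (fun w => (c.split w).1) this).trans ?_
    simp only [v, ContinuousLinearEquiv.apply_symm_apply]
    rfl
  · have h1 : v x = mfderiv J 𝓘(ℝ, E) c.dom x z := by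
      have h2 := c.mfderiv_cod_comp hf c.mem_source z
      rw [hz] at h2
      refine (c.split.symm_apply_eq).2 (Prod.ext h2 rfl)
    refine Eq.trans ?_ (c.mfderiv_symm_comp_dom c.mem_source z)
    exact congrArg (fun w : E => (mfderiv 𝓘(ℝ, E) J c.dom.symm (c.dom x) w : E)) h1

end SubmersionChart

variable {f : M → N}

lemma exists_local_section [J.Boundaryless] [J'.Boundaryless]
    (h : Manifold.IsSubmersion J J' ∞ f) (x : M) :
    ∃ (σ : N → M) (U : Set N), IsOpen U ∧ f x ∈ U ∧ ContMDiffOn J' J ∞ σ U ∧ σ (f x) = x ∧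
      ∀ p ∈ U, f (σ p) = p := by
  obtain ⟨F, _, _, ⟨c⟩⟩ := exists_submersionChart (h.isSubmersionAt x)
  exact c.exists_local_section

/-- Differentiate `f ∘ σ = id` for a local section `σ` through `x`. -/
lemma mfderiv_surjective_of_isSubmersion [J.Boundaryless] [J'.Boundaryless]
    (h : Manifold.IsSubmersion J J' ∞ f) (x : M) :
    Function.Surjective (mfderiv J J' f x) := by
  obtain ⟨σ, U, hU, hxU, hσ, hσx, hfσ⟩ := exists_local_section h x
  intro v
  have h1 : MDifferentiableAt J' J σ (f x) :=
    (hσ.contMDiffAt (hU.mem_nhds hxU)).mdifferentiableAt (by simp)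
  have h2 : MDifferentiableAt J J' f (σ (f x)) := h.contMDiff.mdifferentiableAt (by simp)
  have h3 : f ∘ σ =ᶠ[𝓝 (f x)] id := by
    filter_upwards [hU.mem_nhds hxU] with z hz
    exact hfσ z hz
  have h4 := h3.mfderiv_eq (I := J') (I' := J')
  rw [mfderiv_comp _ h2 h1, mfderiv_id] at h4
  refine ⟨(mfderiv J' J σ (f x) v : E), ?_⟩
  have key : ∀ z, z = x → ∀ w : E, (mfderiv J J' f x w : E') = (mfderiv J J' f z w : E') := by
    rintro _ rfl w; rfl
  refine (key _ hσx _).trans ?_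
  exact congrArg (fun l : E' →L[ℝ] E' => l v) h4

/-- Locally `g = (g ∘ f) ∘ σ` with `σ` a smooth section. This is how smoothness descends to `P₀`. -/
lemma contMDiff_of_comp_submersion [J.Boundaryless] [J'.Boundaryless]
    (h : Manifold.IsSubmersion J J' ∞ f)
    (hsurj : Function.Surjective f) {g : N → ℝ} (hg : ContMDiff J 𝓘(ℝ) ∞ (g ∘ f)) :
    ContMDiff J' 𝓘(ℝ) ∞ g := by
  intro p
  obtain ⟨x, rfl⟩ := hsurj p
  obtain ⟨σ, U, hU, hxU, hσ, hσx, hfσ⟩ := exists_local_section h x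
  refine ((hg.comp_contMDiffOn hσ).contMDiffAt (hU.mem_nhds hxU)).congr_of_eventuallyEq ?_
  filter_upwards [hU.mem_nhds hxU] with q hq
  simp [hfσ q hq]

/-- A vector field transported by a submersion along a local section. -/
lemma contMDiffOn_pushforward [IsManifold J ∞ M] [IsManifold J' ∞ N]
    (h : Manifold.IsSubmersion J J' ∞ f) {σ : N → M} {U : Set N}
    (hσ : ContMDiffOn J' J ∞ σ U) (hfσ : ∀ p ∈ U, f (σ p) = p) {Z : ∀ x : M, TangentSpace J x}
    (hZ : IsSmoothVectorField J Z) :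
    ContMDiffOn J' J'.tangent ∞
      (fun p => (⟨p, (mfderiv J J' f (σ p) (Z (σ p)) : E')⟩ : TangentBundle J' N)) U := by
  have h1 : ContMDiff J J'.tangent ∞ (fun x => (⟨f x, mfderiv J J' f x (Z x)⟩ : TangentBundle J' N)) :=
    (h.contMDiff.contMDiff_tangentMap (m := ∞) (by simp)).comp hZ
  refine (h1.comp_contMDiffOn hσ).congr fun p hp => ?_
  exact congrArg (fun q => (⟨q, (mfderiv J J' f (σ p) (Z (σ p)) : E')⟩ : TangentBundle J' N))
    (hfσ p hp).symm

/-- Vector fields lift along a submersion, with a prescribed value at a point. -/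
lemma exists_lift [J.Boundaryless] [J'.Boundaryless] [FiniteDimensional ℝ E]
    [IsManifold J ∞ M] [IsManifold J' ∞ N]
    [SigmaCompactSpace M] [T2Space M] (h : Manifold.IsSubmersion J J' ∞ f)
    {Z₀ : ∀ p : N, TangentSpace J' p} (hZ₀ : IsSmoothVectorField J' Z₀) (x : M)
    (z : TangentSpace J x) (hz : mfderiv J J' f x z = Z₀ (f x)) :
    ∃ Z : ∀ y : M, TangentSpace J y, IsSmoothVectorField J Z ∧
      (∀ y, mfderiv J J' f y (Z y) = Z₀ (f y)) ∧ Z x = z := by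
  -- Lifts of a given vector form an affine subspace, and fixing the value at `x` cuts out a point,
  -- so local lifts can be glued.
  have conv : ∀ y : M, Convex ℝ {w : TangentSpace J y |
      mfderiv J J' f y w = Z₀ (f y) ∧ ∀ e : y = x, w = e ▸ z} := by
    intro y a ha b hb c d _ _ hcd
    refine ⟨?_, fun e => ?_⟩
    · rw [map_add, map_smul, map_smul, ha.1, hb.1, ← add_smul, hcd, one_smul]
    · rw [ha.2 e, hb.2 e, ← add_smul, hcd, one_smul]
  obtain ⟨Z, h1, h2⟩ := exists_smooth_vectorField_of_local _ conv fun x₀ => by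
    obtain ⟨F, _, _, ⟨c⟩⟩ := exists_submersionChart (h.isSubmersionAt x₀)
    by_cases e : x₀ = x
    · subst e
      obtain ⟨U, hU, s, hs, h1, h2⟩ := c.exists_local_lift h.contMDiff hZ₀ z hz
      exact ⟨U, hU, s, hs, fun y hy => ⟨h1 y hy, by rintro rfl; exact h2⟩⟩
    · obtain ⟨z', hz'⟩ := mfderiv_surjective_of_isSubmersion h x₀ (Z₀ (f x₀))
      obtain ⟨U, hU, s, hs, h1, -⟩ := c.exists_local_lift h.contMDiff hZ₀ z' hz'
      exact ⟨U ∩ {x}ᶜ, inter_mem hU (isOpen_compl_singleton.mem_nhds e), s,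
        hs.mono inter_subset_left, fun y hy => ⟨h1 y hy.1, fun e' => absurd e' hy.2⟩⟩
  exact ⟨Z, h1, fun y => (h2 y).1, (h2 x).2 rfl⟩

end Submersions

end KSymp

namespace KSymp

open Set Filter Topology Bundle

/-! ### The derivative of `i(Z) de` at a point where the equation is solvable. -/

section Constraints

variable {E : Type*} [NormedAddCommGroup E] [NormedSpace ℝ E]
  {H : Type*} [TopologicalSpace H] {J : ModelWithCorners ℝ E H}
  {M : Type*} [TopologicalSpace M] [ChartedSpace H M]

/-- The product is `o(1) · O(‖y - z‖)`; hence continuity of `c` suffices and only `Y` has to be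
differentiable. -/
lemma hasFDerivAt_apply_of_eq_zero {c : E → E →L[ℝ] ℝ} {Y : E → E} {z : E}
    (hc : ContinuousAt c z) (hcz : c z = 0) (hY : DifferentiableAt ℝ Y z) (hYz : Y z = 0) :
    HasFDerivAt (fun y => c y (Y y)) (0 : E →L[ℝ] ℝ) z := by
  rw [hasFDerivAt_iff_isLittleO]
  have h1 : (fun y => Y y) =O[𝓝 z] fun y => y - z := by
    simpa [hYz] using hY.hasFDerivAt.isBigO_sub
  have h2 : (fun y => c y) =o[𝓝 z] fun _ => (1 : ℝ) := by
    rw [Asymptotics.isLittleO_one_iff, ← hcz]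
    exact hc
  have h3 : (fun y => c y (Y y)) =O[𝓝 z] fun y => ‖c y‖ * ‖Y y‖ :=
    Asymptotics.IsBigO.of_bound 1 (Eventually.of_forall fun y => by
      simpa using (c y).le_opNorm (Y y))
  have h4 := h3.trans_isLittleO (h2.norm_left.mul_isBigO h1.norm_norm)
  simp only [hcz, zero_apply, sub_zero]
  refine h4.trans_isBigO ?_
  simpa using Asymptotics.isBigO_refl _ _

lemma extDeriv_formInChart_apply {θ : ∀ x : M, TangentSpace J x →L[ℝ] ℝ} {c : M} {z : E}
    (h : DifferentiableAt ℝ (covectorInChart J θ c) z) (a b : E) :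
    extDeriv (formInChart J θ c) z ![a, b] =
      fderiv ℝ (covectorInChart J θ c) z a b - fderiv ℝ (covectorInChart J θ c) z b a := by
  have h1 : DifferentiableAt ℝ (formInChart J θ c) z := by
    rw [formInChart_eq]
    exact (ContinuousAlternatingMap.ofSubsingletonLIE (𝕜 := ℝ) (E := E) (F := ℝ)
      (0 : Fin 1)).differentiableAt.comp z h
  have h2 : ∀ v : E, HasFDerivAt (fun y => covectorInChart J θ c y v)
      ((fderiv ℝ (covectorInChart J θ c) z).flip v) z := fun v => by
    simpa using h.hasFDerivAt.clm_apply (hasFDerivAt_const v z)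
  rw [extDeriv_apply h1, Fin.sum_univ_two]
  have e0 : (fun y => formInChart J θ c y ((0 : Fin 2).removeNth ![a, b])) =
      fun y => covectorInChart J θ c y b := rfl
  have e1 : (fun y => formInChart J θ c y ((1 : Fin 2).removeNth ![a, b])) =
      fun y => covectorInChart J θ c y a := rfl
  rw [e0, e1, (h2 b).fderiv, (h2 a).fderiv]
  simp [sub_eq_add_neg]

/-- A vector at `x` for each index solves `∑ i(w_α) (-dΘ^α) = de` at `x`. -/
def Solves (J : ModelWithCorners ℝ E H) {k : ℕ}
    (Θ : Fin k → ∀ x : M, TangentSpace J x →L[ℝ] ℝ) (e : M → ℝ) (x : M)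
    (w : Fin k → TangentSpace J x) : Prop :=
  ∀ v : TangentSpace J x, ∑ α, - extDerivForm J (Θ α) x (w α) v = mvfderiv J e x v

/-- `Z` is a smooth vector field in the common kernel of the 2-forms `dΘ^α`. -/
def InKernel (J : ModelWithCorners ℝ E H) [IsManifold J 1 M] {k : ℕ}
    (Θ : Fin k → ∀ x : M, TangentSpace J x →L[ℝ] ℝ) (Z : ∀ x : M, TangentSpace J x) : Prop :=
  IsSmoothVectorField J Z ∧ ∀ x α (u : TangentSpace J x), extDerivForm J (Θ α) x u (Z x) = 0

/-- The vectors `w_α` at `x` annihilate the functions `i(Z) de` for `Z` in the common kernel of the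
2-forms `dΘ^α`. -/
def IsTangent (J : ModelWithCorners ℝ E H) [IsManifold J 1 M] {k : ℕ}
    (Θ : Fin k → ∀ x : M, TangentSpace J x →L[ℝ] ℝ) (e : M → ℝ) (x : M)
    (w : Fin k → TangentSpace J x) : Prop :=
  ∀ Z, InKernel J Θ Z → ∀ α, mvfderiv J (fun y => mvfderiv J e y (Z y)) x (w α) = 0

/-- The derivative at `x` of `i(Y) de` vanishes if `Y` vanishes at `x`, lies in the kernel of the
2-forms `dΘ^α`, and `de` lies at `x` in the image of these forms. -/
lemma mvfderiv_contraction_eq_zero [J.Boundaryless] [IsManifold J ∞ M] {k : ℕ}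
    {Θ : Fin k → ∀ x : M, TangentSpace J x →L[ℝ] ℝ} (hΘ : ∀ α, IsSmoothForm J (Θ α)) {e : M → ℝ}
    (he : ContMDiff J 𝓘(ℝ) ∞ e) {Y : ∀ x : M, TangentSpace J x} (hY : InKernel J Θ Y) {x : M}
    (hYx : Y x = 0) {u : Fin k → TangentSpace J x} (hu : Solves J Θ e x u) :
    mvfderiv J (fun y => mvfderiv J e y (Y y)) x = 0 := by
  have : IsManifold J 1 M := .of_le (n := ∞) (by simp)
  set φ := extChartAt J x with hφ
  let D : ∀ y : M, TangentSpace J y → E := fun y v => mfderiv J 𝓘(ℝ, E) φ y v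
  have hmem : ∀ z ∈ φ.target, φ.symm z ∈ (chartAt H x).source := fun z hz => by
    rw [← extChartAt_source J]; exact φ.map_target hz
  let e' : E → ℝ := e ∘ φ.symm
  have hφs : ContMDiffOn 𝓘(ℝ, E) J ∞ φ.symm φ.target := contMDiffOn_extChartAt_symm x
  have he' : ContDiffOn ℝ ∞ e' φ.target :=
    contMDiffOn_iff_contDiffOn.1 (he.comp_contMDiffOn hφs)
  have hopen : IsOpen φ.target := isOpen_extChartAt_target x
  have hz₀ : φ x ∈ φ.target := mem_extChartAt_target x
  have hinv : φ.symm (φ x) = x := extChartAt_to_inv x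
  -- the differential of `e` in the chart
  have hde : ∀ y ∈ (chartAt H x).source, ∀ v : TangentSpace J y,
      fderiv ℝ e' (φ y) (D y v) = mvfderiv J e y v := by
    intro y hy v
    have hyt : φ y ∈ φ.target := φ.map_source (by rwa [hφ, extChartAt_source])
    have hl : φ.symm (φ y) = y := φ.left_inv (by rwa [hφ, extChartAt_source])
    have h1 : MDifferentiableAt 𝓘(ℝ, E) 𝓘(ℝ) e' (φ y) :=
      ((he'.contDiffAt (hopen.mem_nhds hyt)).differentiableAt (by simp)).mdifferentiableAt
    have h2 : MDifferentiableAt J 𝓘(ℝ, E) φ y := mdifferentiableAt_extChartAt hy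
    have h3 : e' ∘ φ =ᶠ[𝓝 y] e := by
      filter_upwards [(chartAt H x).open_source.mem_nhds hy] with q hq
      exact congrArg e (φ.left_inv (by rwa [hφ, extChartAt_source]))
    have h4 := h3.mfderiv_eq (I := J) (I' := 𝓘(ℝ))
    rw [mfderiv_comp y h1 h2, mfderiv_eq_fderiv] at h4
    exact congrArg (fun l : E →L[ℝ] ℝ => l v) h4
  let u' : Fin k → E := fun α => D x (u α)
  let τ : Fin k → E → E →L[ℝ] ℝ := fun α => covectorInChart J (Θ α) x
  have hτ : ∀ α, ∀ z ∈ φ.target, ContDiffAt ℝ ∞ (τ α) z := fun α z hz =>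
    (hΘ α x).contDiffAt (hopen.mem_nhds hz)
  -- In the chart this is `de + Σ i(u_α) dΘ^α` with `u` extended by constant coefficients `u'`. It
  -- vanishes at `φ x` because `u` solves the equation there; at nearby points `u'` need not be a
  -- solution. Adding the sum does not change the value on `Y'`, since `Y` lies in the kernel at
  -- every point.
  let c : E → E →L[ℝ] ℝ := fun z => fderiv ℝ e' z +
    ∑ α, (fderiv ℝ (τ α) z (u' α) - (fderiv ℝ (τ α) z).flip (u' α))
  let Y' : E → E := fun z => D (φ.symm z) (Y (φ.symm z))
  have hω : ∀ y ∈ (chartAt H x).source, ∀ α, ∀ a b : TangentSpace J y,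
      extDerivForm J (Θ α) y a b =
        fderiv ℝ (τ α) (φ y) (D y a) (D y b) - fderiv ℝ (τ α) (φ y) (D y b) (D y a) := by
    intro y hy α a b
    have hyt : φ y ∈ φ.target := φ.map_source (by rwa [hφ, extChartAt_source])
    rw [extDerivForm_eq_of_mem_chart (hΘ α) hy]
    exact extDeriv_formInChart_apply ((hτ α _ hyt).differentiableAt (by simp)) _ _
  have hc : ContinuousAt c (φ x) := by
    have h1 : ContinuousAt (fderiv ℝ e') (φ x) :=
      ((he'.contDiffAt (hopen.mem_nhds hz₀)).fderiv_right (m := ∞) (by simp)).continuousAt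
    have h2 : ∀ α, ContinuousAt (fderiv ℝ (τ α)) (φ x) := fun α =>
      ((hτ α _ hz₀).fderiv_right (m := ∞) (by simp)).continuousAt
    refine h1.add (tendsto_finsetSum _ fun α _ => ContinuousAt.sub ?_ ?_)
    · exact (h2 α).clm_apply continuousAt_const
    · exact ((ContinuousLinearMap.flipₗᵢ ℝ E E ℝ).continuous.continuousAt.comp
        (h2 α)).clm_apply continuousAt_const
  have hcz : c (φ x) = 0 := by
    ext v
    obtain ⟨v', rfl⟩ : ∃ v' : TangentSpace J x, D x v' = v := by
      have h := mfderiv_extChartAt_comp_symm (J := J) hz₀ v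
      refine ⟨(mfderiv 𝓘(ℝ, E) J φ.symm (φ x) v : E), ?_⟩
      have key : ∀ q, q = x → ∀ a : E, (D x a : E) = D q a := by rintro _ rfl _; rfl
      exact (key _ hinv _).trans h
    have h1 := hu v'
    have hx : x ∈ (chartAt H x).source := mem_chart_source H x
    simp only [hω x hx, ← hde x hx] at h1
    simp only [c, u', add_apply, sum_apply,
      sub_apply, ContinuousLinearMap.flip_apply, ← h1,
      zero_apply]
    rw [← Finset.sum_add_distrib]
    simp
  have hY'z : Y' (φ x) = 0 := by
    have key : ∀ q, q = x → (D q (Y q) : E) = D x (Y x) := by rintro _ rfl; rfl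
    refine (key _ hinv).trans ?_
    simp only [D, hYx, map_zero]
    rfl
  have hder := hasFDerivAt_apply_of_eq_zero hc hcz
    (differentiableAt_vectorField_inChart hY.1 x) hY'z
  have hF : MDifferentiableAt J 𝓘(ℝ) (fun y => mvfderiv J e y (Y y)) x :=
    (contMDiff_mvfderiv_apply he hY.1).mdifferentiableAt (by simp)
  have hev : (fun z => c z (Y' z)) =ᶠ[𝓝 (φ x)]
      writtenInExtChartAt J 𝓘(ℝ) x (fun y => mvfderiv J e y (Y y)) := by
    filter_upwards [hopen.mem_nhds hz₀] with z hz
    have hy := hmem z hz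
    have hr : φ (φ.symm z) = z := φ.right_inv hz
    have h1 := hde _ hy (Y (φ.symm z))
    rw [hr] at h1
    have h2 : ∀ α, fderiv ℝ (τ α) z (u' α) (Y' z) - fderiv ℝ (τ α) z (Y' z) (u' α) = 0 := by
      intro α
      have h3 := hω _ hy α (mfderiv 𝓘(ℝ, E) J φ.symm z (u' α)) (Y (φ.symm z))
      rw [hY.2, hr] at h3
      have h4 : (D (φ.symm z) (mfderiv 𝓘(ℝ, E) J φ.symm z (u' α)) : E) = u' α :=
        mfderiv_extChartAt_comp_symm (J := J) hz (u' α)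
      rw [h4] at h3
      exact h3.symm
    have h5 : c z (Y' z) = fderiv ℝ e' z (Y' z) +
        ∑ α, (fderiv ℝ (τ α) z (u' α) (Y' z) - fderiv ℝ (τ α) z (Y' z) (u' α)) := by
      simp [c]
    rw [h5, Finset.sum_eq_zero fun α _ => h2 α, add_zero]
    exact h1
  rw [hF.mvfderiv, J.range_eq_univ, fderivWithin_univ]
  exact (hder.congr_of_eventuallyEq hev.symm).fderiv

end Constraints

end KSymp

namespace KSymp

open Set Filter Topology Bundle

/-! ### Descent of the equation, its kernel and its tangency condition along a submersion. -/

section Projection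

universe u

variable {E : Type u} [NormedAddCommGroup E] [NormedSpace ℝ E]
  {H : Type*} [TopologicalSpace H] {J : ModelWithCorners ℝ E H}
  {M : Type*} [TopologicalSpace M] [ChartedSpace H M]
  {E' : Type*} [NormedAddCommGroup E'] [NormedSpace ℝ E']
  {H' : Type*} [TopologicalSpace H'] {J' : ModelWithCorners ℝ E' H'}
  {N : Type*} [TopologicalSpace N] [ChartedSpace H' N]
  {k : ℕ}

lemma mvfderiv_comp_apply {f : M → N} {g : N → ℝ} (hg : ContMDiff J' 𝓘(ℝ) ∞ g)
    (hf : ContMDiff J J' ∞ f) (x : M) (v : TangentSpace J x) :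
    mvfderiv J (fun y => g (f y)) x v = mvfderiv J' g (f x) (mfderiv J J' f x v) := by
  have h := mfderiv_comp x (hg.mdifferentiableAt (x := f x) (by simp))
    (hf.mdifferentiableAt (x := x) (by simp))
  exact congrArg (fun l : E →L[ℝ] ℝ => l v) h

lemma extDerivForm_add_right (θ : ∀ x : M, TangentSpace J x →L[ℝ] ℝ) (x : M)
    (u w w' : TangentSpace J x) :
    extDerivForm J θ x u (w + w') = extDerivForm J θ x u w + extDerivForm J θ x u w' := by
  rw [extDerivForm_swap, extDerivForm_add_left, extDerivForm_swap θ x w, extDerivForm_swap θ x w']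
  ring

lemma extDerivForm_smul_right (θ : ∀ x : M, TangentSpace J x →L[ℝ] ℝ) (x : M) (a : ℝ)
    (u w : TangentSpace J x) :
    extDerivForm J θ x u (a • w) = a * extDerivForm J θ x u w := by
  rw [extDerivForm_swap, extDerivForm_smul_left, extDerivForm_swap θ x w]
  ring

lemma extDerivForm_zero_left (θ : ∀ x : M, TangentSpace J x →L[ℝ] ℝ) (x : M)
    (w : TangentSpace J x) : extDerivForm J θ x 0 w = 0 := by
  simpa using extDerivForm_smul_left θ x 0 0 w

lemma extDerivForm_zero_right (θ : ∀ x : M, TangentSpace J x →L[ℝ] ℝ) (x : M)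
    (w : TangentSpace J x) : extDerivForm J θ x w 0 = 0 := by
  rw [extDerivForm_swap, extDerivForm_zero_left, neg_zero]

/-- The equation is affine in `w`. With `convex_isTangent`, where the condition is linear, this is
what permits gluing of local solutions. -/
lemma convex_solves (Θ : Fin k → ∀ x : M, TangentSpace J x →L[ℝ] ℝ) (e : M → ℝ) (x : M) :
    Convex ℝ {w | Solves J Θ e x w} := by
  intro w hw w' hw' a b _ _ hab v
  simp only [Pi.add_apply, Pi.smul_apply, extDerivForm_add_left, extDerivForm_smul_left]
  calc _ = a * ∑ α, - extDerivForm J (Θ α) x (w α) v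
        + b * ∑ α, - extDerivForm J (Θ α) x (w' α) v := by
        rw [Finset.mul_sum, Finset.mul_sum, ← Finset.sum_add_distrib]
        exact Finset.sum_congr rfl fun α _ => by ring
    _ = _ := by rw [hw v, hw' v, ← add_mul, hab, one_mul]

lemma convex_isTangent [IsManifold J 1 M] (Θ : Fin k → ∀ x : M, TangentSpace J x →L[ℝ] ℝ)
    (e : M → ℝ) (x : M) : Convex ℝ {w | IsTangent J Θ e x w} := by
  intro w hw w' hw' a b _ _ _ Z hZ α
  simp only [Pi.add_apply, Pi.smul_apply, map_add, map_smul, hw Z hZ α, hw' Z hZ α, smul_zero,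
    add_zero]

lemma InKernel.sub [IsManifold J 1 M] [IsManifold J ∞ M]
    {Θ : Fin k → ∀ x : M, TangentSpace J x →L[ℝ] ℝ}
    {Z Z' : ∀ x : M, TangentSpace J x} (h : InKernel J Θ Z) (h' : InKernel J Θ Z') :
    InKernel J Θ (fun x => Z x - Z' x) := by
  refine ⟨h.1.sub h'.1, fun x α u => ?_⟩
  have := extDerivForm_smul_right (Θ α) x (-1) u (Z' x)
  rw [neg_one_smul] at this
  simp only [sub_eq_add_neg]
  rw [extDerivForm_add_right, this, h.2, h'.2]
  simp

/-- The differential of `i(Z) de` at a point where `de` lies in the image of the 2-forms depends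
only on the value of `Z` at the point. -/
lemma mvfderiv_contraction_congr [J.Boundaryless] [IsManifold J 1 M] [IsManifold J ∞ M]
    {Θ : Fin k → ∀ x : M, TangentSpace J x →L[ℝ] ℝ} (hΘ : ∀ α, IsSmoothForm J (Θ α)) {e : M → ℝ}
    (he : ContMDiff J 𝓘(ℝ) ∞ e) {Z Z' : ∀ x : M, TangentSpace J x} (hZ : InKernel J Θ Z)
    (hZ' : InKernel J Θ Z') {x : M} (hx : Z x = Z' x) (hu : ∃ u, Solves J Θ e x u) :
    mvfderiv J (fun y => mvfderiv J e y (Z y)) x = mvfderiv J (fun y => mvfderiv J e y (Z' y)) x := by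
  obtain ⟨u, hu⟩ := hu
  have h := mvfderiv_contraction_eq_zero hΘ he (hZ.sub hZ') (by simp [hx]) hu
  simp only [map_sub] at h
  rw [mvfderiv_fun_sub ((contMDiff_mvfderiv_apply he hZ.1).mdifferentiableAt (by simp))
    ((contMDiff_mvfderiv_apply he hZ'.1).mdifferentiableAt (by simp))] at h
  exact sub_eq_zero.1 h

/-- Vector fields on the source and on the target of a map that are related by it. -/
def IsRelated (J : ModelWithCorners ℝ E H) (J' : ModelWithCorners ℝ E' H') (f : M → N)
    (Z : ∀ x : M, TangentSpace J x) (Z₀ : ∀ p : N, TangentSpace J' p) : Prop :=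
  ∀ x, mfderiv J J' f x (Z x) = Z₀ (f x)

lemma contraction_comp {f : M → N} {h : N → ℝ} (hf : ContMDiff J J' ∞ f)
    (hh : ContMDiff J' 𝓘(ℝ) ∞ h) {Z : ∀ x : M, TangentSpace J x} {Z₀ : ∀ p : N, TangentSpace J' p}
    (hrel : IsRelated J J' f Z Z₀) :
    (fun x => mvfderiv J (fun y => h (f y)) x (Z x)) =
      fun x => mvfderiv J' h (f x) (Z₀ (f x)) := by
  funext x
  rw [mvfderiv_comp_apply hh hf, hrel x]

lemma mvfderiv_contraction_comp [IsManifold J' 1 N] [IsManifold J' ∞ N] {f : M → N} {h : N → ℝ}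
    (hf : ContMDiff J J' ∞ f) (hh : ContMDiff J' 𝓘(ℝ) ∞ h)
    {Z : ∀ x : M, TangentSpace J x} {Z₀ : ∀ p : N, TangentSpace J' p}
    (hZ₀ : IsSmoothVectorField J' Z₀) (hrel : IsRelated J J' f Z Z₀) (x : M)
    (v : TangentSpace J x) :
    mvfderiv J (fun x => mvfderiv J (fun y => h (f y)) x (Z x)) x v =
      mvfderiv J' (fun p => mvfderiv J' h p (Z₀ p)) (f x) (mfderiv J J' f x v) := by
  rw [contraction_comp hf hh hrel]
  exact mvfderiv_comp_apply (contMDiff_mvfderiv_apply hh hZ₀) hf x v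

variable [J.Boundaryless] [J'.Boundaryless] [IsManifold J ∞ M] [IsManifold J' ∞ N] {f : M → N}
  {θ : Fin k → ∀ p : N, TangentSpace J' p →L[ℝ] ℝ} {h : N → ℝ}

/-- Both sides factor through `df`, and testing on `df(v)` for all `v` is testing on all vectors at
`f x`. -/
lemma solves_comp_iff (hf : Manifold.IsSubmersion J J' ∞ f) (hθ : ∀ α, IsSmoothForm J' (θ α))
    (hh : ContMDiff J' 𝓘(ℝ) ∞ h) (x : M) (w : Fin k → TangentSpace J x) :
    Solves J (fun α => pullbackForm J J' f (θ α)) (fun y => h (f y)) x w ↔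
      Solves J' θ h (f x) (fun α => mfderiv J J' f x (w α)) := by
  unfold Solves
  rw [(mfderiv_surjective_of_isSubmersion hf x).forall]
  simp only [mvfderiv_comp_apply hh hf.contMDiff, extDerivForm_pullback (hθ _) hf.contMDiff]

/-- The points at which `de` lies in the image of the 2-forms. -/
def solvableSet (J : ModelWithCorners ℝ E H) (Θ : Fin k → ∀ x : M, TangentSpace J x →L[ℝ] ℝ)
    (e : M → ℝ) : Set M :=
  {x | ∃ u, Solves J Θ e x u}

lemma mem_solvableSet_comp_iff (hf : Manifold.IsSubmersion J J' ∞ f)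
    (hθ : ∀ α, IsSmoothForm J' (θ α)) (hh : ContMDiff J' 𝓘(ℝ) ∞ h) (x : M) :
    x ∈ solvableSet J (fun α => pullbackForm J J' f (θ α)) (fun y => h (f y)) ↔
      f x ∈ solvableSet J' θ h := by
  constructor
  · rintro ⟨u, hu⟩
    exact ⟨_, (solves_comp_iff hf hθ hh x u).1 hu⟩
  · rintro ⟨u, hu⟩
    choose w hw using fun α => mfderiv_surjective_of_isSubmersion hf x (u α)
    refine ⟨w, (solves_comp_iff hf hθ hh x w).2 ?_⟩
    simpa only [hw] using hu

variable [IsManifold J 1 M] [IsManifold J' 1 N]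

lemma inKernel_comp_iff (hf : Manifold.IsSubmersion J J' ∞ f) (hsurj : Function.Surjective f)
    (hθ : ∀ α, IsSmoothForm J' (θ α)) {Z : ∀ x : M, TangentSpace J x}
    {Z₀ : ∀ p : N, TangentSpace J' p} (hZ : IsSmoothVectorField J Z)
    (hZ₀ : IsSmoothVectorField J' Z₀) (hrel : IsRelated J J' f Z Z₀) :
    InKernel J (fun α => pullbackForm J J' f (θ α)) Z ↔ InKernel J' θ Z₀ := by
  unfold InKernel
  simp only [hZ, hZ₀, true_and]
  rw [hsurj.forall]
  refine forall_congr' fun x => forall_congr' fun α => ?_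
  rw [(mfderiv_surjective_of_isSubmersion hf x).forall]
  simp only [extDerivForm_pullback (hθ _) hf.contMDiff, hrel x]

lemma exists_lift_inKernel [FiniteDimensional ℝ E] [SigmaCompactSpace M] [T2Space M]
    (hf : Manifold.IsSubmersion J J' ∞ f) (hsurj : Function.Surjective f)
    (hθ : ∀ α, IsSmoothForm J' (θ α)) {Z₀ : ∀ p : N, TangentSpace J' p} (hZ₀ : InKernel J' θ Z₀)
    (x : M) (z : TangentSpace J x) (hz : mfderiv J J' f x z = Z₀ (f x)) :
    ∃ Z, InKernel J (fun α => pullbackForm J J' f (θ α)) Z ∧ IsRelated J J' f Z Z₀ ∧ Z x = z := by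
  obtain ⟨Z, hZ, hrel, hx⟩ := exists_lift hf hZ₀.1 x z hz
  exact ⟨Z, (inKernel_comp_iff hf hsurj hθ hZ hZ₀.1 hrel).2 hZ₀, hrel, hx⟩

/-- As `Z` need not be projectable, it is pushed forward only along one local section through `x`
and glued with zero. The kernel condition is linear, so it survives gluing, but agreement with `Z`
is ensured only at `x`. -/
lemma exists_pushforward_inKernel [FiniteDimensional ℝ E'] [SigmaCompactSpace N] [T2Space N]
    (hf : Manifold.IsSubmersion J J' ∞ f)
    (hθ : ∀ α, IsSmoothForm J' (θ α)) {Z : ∀ x : M, TangentSpace J x}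
    (hZ : InKernel J (fun α => pullbackForm J J' f (θ α)) Z) (x : M) :
    ∃ Z₀, InKernel J' θ Z₀ ∧ mfderiv J J' f x (Z x) = Z₀ (f x) := by
  have conv : ∀ p : N, Convex ℝ {w : TangentSpace J' p |
      (∀ α (u : TangentSpace J' p), extDerivForm J' (θ α) p u w = 0) ∧
        ∀ e : p = f x, w = e ▸ mfderiv J J' f x (Z x)} := by
    intro p a ha b hb c d _ _ hcd
    refine ⟨fun α u => ?_, fun e => ?_⟩
    · simp [extDerivForm_add_right, extDerivForm_smul_right, ha.1, hb.1]
    · rw [ha.2 e, hb.2 e, ← add_smul, hcd, one_smul]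
  obtain ⟨Z₀, h1, h2⟩ := exists_smooth_vectorField_of_local _ conv fun p => by
    by_cases e : p = f x
    · subst e
      obtain ⟨σ, U, hU, hxU, hσ, hσx, hfσ⟩ := exists_local_section hf x
      refine ⟨U, hU.mem_nhds hxU, _, contMDiffOn_pushforward hf hσ hfσ hZ.1,
        fun p hp => ⟨fun α => ?_, ?_⟩⟩
      · have key : ∀ q, f (σ p) = q → ∀ u : TangentSpace J' q, extDerivForm J' (θ α) q u
            (mfderiv J J' f (σ p) (Z (σ p)) : E') = 0 := by
          rintro _ rfl
          rw [(mfderiv_surjective_of_isSubmersion hf (σ p)).forall]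
          intro u
          rw [← extDerivForm_pullback (hθ α) hf.contMDiff]
          exact hZ.2 _ α u
        exact key p (hfσ p hp)
      · rintro rfl
        have key : ∀ y, y = x → (mfderiv J J' f y (Z y) : E') = mfderiv J J' f x (Z x) := by
          rintro _ rfl; rfl
        exact key _ hσx
    · refine ⟨{f x}ᶜ, isOpen_compl_singleton.mem_nhds e, 0, (contMDiff_zeroSection ℝ _).contMDiffOn,
        fun y hy => ⟨fun α u => extDerivForm_zero_right _ _ _, fun e' => absurd e' hy⟩⟩
  exact ⟨Z₀, ⟨h1, fun p α u => (h2 p).1 α u⟩, ((h2 (f x)).2 rfl).symm⟩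

/-- Every kernel field on `N` lifts to a kernel field on `M`, and the contraction by the lift is the
pull-back of the contraction below. -/
lemma isTangent_comp_of [FiniteDimensional ℝ E] [SigmaCompactSpace M] [T2Space M]
    (hf : Manifold.IsSubmersion J J' ∞ f) (hsurj : Function.Surjective f)
    (hθ : ∀ α, IsSmoothForm J' (θ α)) (hh : ContMDiff J' 𝓘(ℝ) ∞ h) {x : M}
    {w : Fin k → TangentSpace J x}
    (hw : IsTangent J (fun α => pullbackForm J J' f (θ α)) (fun y => h (f y)) x w) :
    IsTangent J' θ h (f x) (fun α => mfderiv J J' f x (w α)) := by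
  intro Z₀ hZ₀ α
  obtain ⟨z, hz⟩ := mfderiv_surjective_of_isSubmersion hf x (Z₀ (f x))
  obtain ⟨Z, hZ, hrel, -⟩ := exists_lift_inKernel hf hsurj hθ hZ₀ x z hz
  rw [← mvfderiv_contraction_comp hf.contMDiff hh hZ₀.1 hrel]
  exact hw Z hZ α

variable [FiniteDimensional ℝ E] [SigmaCompactSpace M] [T2Space M]
  [FiniteDimensional ℝ E'] [SigmaCompactSpace N] [T2Space N]

lemma exists_projectable_inKernel (hf : Manifold.IsSubmersion J J' ∞ f)
    (hsurj : Function.Surjective f) (hθ : ∀ α, IsSmoothForm J' (θ α))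
    {Z : ∀ x : M, TangentSpace J x} (hZ : InKernel J (fun α => pullbackForm J J' f (θ α)) Z)
    (x : M) :
    ∃ Z' Z₀, InKernel J (fun α => pullbackForm J J' f (θ α)) Z' ∧ InKernel J' θ Z₀ ∧
      IsRelated J J' f Z' Z₀ ∧ Z' x = Z x := by
  obtain ⟨Z₀, h0, hx⟩ := exists_pushforward_inKernel hf hθ hZ x
  obtain ⟨Z', h1, hrel, hx'⟩ := exists_lift_inKernel hf hsurj hθ h0 x (Z x) hx
  exact ⟨Z', Z₀, h1, h0, hrel, hx'⟩

/-- A general `Z` upstairs is exchanged for a projectable field with the same value at `x`. This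
leaves the differential of the contraction unchanged only where the equation is solvable, whence the
hypothesis `hx`. -/
lemma isTangent_of_comp (hf : Manifold.IsSubmersion J J' ∞ f) (hsurj : Function.Surjective f)
    (hθ : ∀ α, IsSmoothForm J' (θ α)) (hh : ContMDiff J' 𝓘(ℝ) ∞ h) {x : M}
    (hx : ∃ u, Solves J (fun α => pullbackForm J J' f (θ α)) (fun y => h (f y)) x u)
    {w : Fin k → TangentSpace J x}
    (hw : IsTangent J' θ h (f x) (fun α => mfderiv J J' f x (w α))) :
    IsTangent J (fun α => pullbackForm J J' f (θ α)) (fun y => h (f y)) x w := by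
  intro Z hZ α
  obtain ⟨Z', Z₀, hZ', hZ₀, hrel, hx'⟩ := exists_projectable_inKernel hf hsurj hθ hZ x
  rw [mvfderiv_contraction_congr (e := fun y => h (f y))
    (fun α => (hθ α).pullback hf.contMDiff) (hh.comp hf.contMDiff) hZ hZ' hx'.symm hx,
    mvfderiv_contraction_comp hf.contMDiff hh hZ₀.1 hrel]
  exact hw Z₀ hZ₀ α

/-- `W` is a smooth tuple of vector fields that solves `∑ i(W_α) (-dΘ^α) = de` wherever this
equation has a solution. -/
def IsSolution (J : ModelWithCorners ℝ E H) [IsManifold J 1 M]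
    (Θ : Fin k → ∀ x : M, TangentSpace J x →L[ℝ] ℝ) (e : M → ℝ)
    (W : Fin k → ∀ x : M, TangentSpace J x) : Prop :=
  (∀ α, IsSmoothVectorField J (W α)) ∧
    ∀ x ∈ solvableSet J Θ e, Solves J Θ e x (fun α => W α x)

/-- Solutions can be replaced by projectable ones, with control of the tangency. -/
lemma exists_projectable_solution (hf : Manifold.IsSubmersion J J' ∞ f)
    (hsurj : Function.Surjective f) (hθ : ∀ α, IsSmoothForm J' (θ α))
    (hh : ContMDiff J' 𝓘(ℝ) ∞ h) {W : Fin k → ∀ x : M, TangentSpace J x}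
    (hW : IsSolution J (fun α => pullbackForm J J' f (θ α)) (fun y => h (f y)) W) (T : Set N)
    (hT : ∀ p₀ : N, ∃ (σ : N → M) (U : Set N), U ∈ 𝓝 p₀ ∧ ContMDiffOn J' J ∞ σ U ∧ ∀ p ∈ U,
      f (σ p) = p ∧ (p ∈ T → IsTangent J (fun α => pullbackForm J J' f (θ α)) (fun y => h (f y))
        (σ p) (fun α => W α (σ p)))) :
    ∃ (X : Fin k → ∀ x : M, TangentSpace J x) (X₀ : Fin k → ∀ p : N, TangentSpace J' p),
      IsSolution J (fun α => pullbackForm J J' f (θ α)) (fun y => h (f y)) X ∧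
      (∀ α, IsSmoothVectorField J' (X₀ α)) ∧ (∀ α, IsRelated J J' f (X α) (X₀ α)) ∧
      ∀ x ∈ solvableSet J (fun α => pullbackForm J J' f (θ α)) (fun y => h (f y)), f x ∈ T →
        IsTangent J (fun α => pullbackForm J J' f (θ α)) (fun y => h (f y)) x
          (fun α => X α x) := by
  -- Both requirements are imposed on `N`, where gluing takes place; at `p` the local candidate
  -- involves `W` only at the single point `σ p` of the fibre.
  have conv : ∀ p : N, Convex ℝ {w : Fin k → TangentSpace J' p |
      (p ∈ solvableSet J' θ h → Solves J' θ h p w) ∧ (p ∈ T → IsTangent J' θ h p w)} := by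
    intro p a ha b hb c d hc hd hcd
    exact ⟨fun hp => convex_solves θ h p (ha.1 hp) (hb.1 hp) hc hd hcd,
      fun hp => convex_isTangent θ h p (ha.2 hp) (hb.2 hp) hc hd hcd⟩
  obtain ⟨X₀, hX₀, hX₀t⟩ := exists_smooth_tuple_of_local _ conv fun p₀ => by
    obtain ⟨σ, U, hU, hσ, hfσ⟩ := hT p₀
    refine ⟨U, hU, fun α p => (mfderiv J J' f (σ p) (W α (σ p)) : E'),
      fun α => contMDiffOn_pushforward hf hσ (fun p hp => (hfσ p hp).1) (hW.1 α), fun p hp => ?_⟩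
    have key : ∀ q, f (σ p) = q → (q ∈ solvableSet J' θ h →
        Solves J' θ h q fun α => (mfderiv J J' f (σ p) (W α (σ p)) : E')) := by
      rintro _ rfl hq
      exact (solves_comp_iff hf hθ hh _ _).1
        (hW.2 _ ((mem_solvableSet_comp_iff hf hθ hh _).2 hq))
    have key' : ∀ q, f (σ p) = q → IsTangent J (fun α => pullbackForm J J' f (θ α))
        (fun y => h (f y)) (σ p) (fun α => W α (σ p)) →
        IsTangent J' θ h q fun α => (mfderiv J J' f (σ p) (W α (σ p)) : E') := by
      rintro _ rfl hq
      exact isTangent_comp_of hf hsurj hθ hh hq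
    exact ⟨key p (hfσ p hp).1, fun hpT => key' p (hfσ p hp).1 ((hfσ p hp).2 hpT)⟩
  have hlift : ∀ α, ∃ X : ∀ x : M, TangentSpace J x, IsSmoothVectorField J X ∧
      IsRelated J J' f X (X₀ α) := by
    intro α
    -- `exists_lift` prescribes the value at a point, so a point of `M` is needed.
    rcases isEmpty_or_nonempty M with hM | ⟨⟨x⟩⟩
    · exact ⟨0, contMDiff_zeroSection ℝ _, fun x => isEmptyElim x⟩
    · obtain ⟨z, hz⟩ := mfderiv_surjective_of_isSubmersion hf x (X₀ α (f x))
      obtain ⟨X, h1, h2, -⟩ := exists_lift hf (hX₀ α) x z hz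
      exact ⟨X, h1, h2⟩
  choose X hX hrel using hlift
  have hrel' : ∀ x, (fun α => mfderiv J J' f x (X α x)) = fun α => X₀ α (f x) := fun x =>
    funext fun α => hrel α x
  refine ⟨X, X₀, ⟨hX, fun x hx => ?_⟩, hX₀, hrel, fun x hx hxT => ?_⟩
  · rw [solves_comp_iff hf hθ hh, hrel']
    exact (hX₀t (f x)).1 ((mem_solvableSet_comp_iff hf hθ hh x).1 hx)
  · refine isTangent_of_comp hf hsurj hθ hh hx ?_
    rw [hrel']
    exact (hX₀t (f x)).2 hxT

/-- The points at which some solution is tangent. -/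
def tangencySet (J : ModelWithCorners ℝ E H) [IsManifold J 1 M]
    (Θ : Fin k → ∀ x : M, TangentSpace J x →L[ℝ] ℝ) (e : M → ℝ) : Set M :=
  {x ∈ solvableSet J Θ e | ∃ W, IsSolution J Θ e W ∧ IsTangent J Θ e x (fun α => W α x)}

/-- The case `T = {f x}`: the section over `f x` passes through `x`, and those near other points
avoid `f x`. Tangency holds on the whole fibre because it descends to `N`; thus the tangency set is
a union of fibres. -/
lemma exists_projectable_solution_at (hf : Manifold.IsSubmersion J J' ∞ f)
    (hsurj : Function.Surjective f) (hθ : ∀ α, IsSmoothForm J' (θ α))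
    (hh : ContMDiff J' 𝓘(ℝ) ∞ h) {x : M}
    (hx : x ∈ tangencySet J (fun α => pullbackForm J J' f (θ α)) (fun y => h (f y))) :
    ∃ (X : Fin k → ∀ x : M, TangentSpace J x) (X₀ : Fin k → ∀ p : N, TangentSpace J' p),
      IsSolution J (fun α => pullbackForm J J' f (θ α)) (fun y => h (f y)) X ∧
      (∀ α, IsSmoothVectorField J' (X₀ α)) ∧ (∀ α, IsRelated J J' f (X α) (X₀ α)) ∧
      ∀ y, f y = f x → y ∈ solvableSet J (fun α => pullbackForm J J' f (θ α)) (fun y => h (f y)) ∧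
        IsTangent J (fun α => pullbackForm J J' f (θ α)) (fun y => h (f y)) y
          (fun α => X α y) := by
  obtain ⟨hx1, W, hW, hWx⟩ := hx
  obtain ⟨X, X₀, hX, hX₀, hrel, ht⟩ := exists_projectable_solution hf hsurj hθ hh hW {f x}
    fun p₀ => by
      by_cases hp : p₀ = f x
      · subst hp
        obtain ⟨σ, U, hU, hxU, hσ, hσx, hfσ⟩ := exists_local_section hf x
        refine ⟨σ, U, hU.mem_nhds hxU, hσ, fun p hp => ⟨hfσ p hp, ?_⟩⟩
        rintro rfl
        rw [hσx]
        exact hWx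
      · obtain ⟨y, rfl⟩ := hsurj p₀
        obtain ⟨σ, U, hU, hxU, hσ, -, hfσ⟩ := exists_local_section hf y
        exact ⟨σ, U ∩ {f x}ᶜ, inter_mem (hU.mem_nhds hxU) (isOpen_compl_singleton.mem_nhds hp),
          hσ.mono inter_subset_left, fun p hp => ⟨hfσ p hp.1, fun hp' => absurd hp' hp.2⟩⟩
  refine ⟨X, X₀, hX, hX₀, hrel, fun y hy => ?_⟩
  have hy1 := (mem_solvableSet_comp_iff hf hθ hh y).2
    (hy ▸ (mem_solvableSet_comp_iff hf hθ hh x).1 hx1)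
  exact ⟨hy1, ht y hy1 hy⟩

/-- A solution that is tangent at all points of the tangency set can be replaced by a projectable
one with this property. -/
lemma exists_projectable_solution_on (hf : Manifold.IsSubmersion J J' ∞ f)
    (hsurj : Function.Surjective f) (hθ : ∀ α, IsSmoothForm J' (θ α))
    (hh : ContMDiff J' 𝓘(ℝ) ∞ h) {W : Fin k → ∀ x : M, TangentSpace J x}
    (hW : IsSolution J (fun α => pullbackForm J J' f (θ α)) (fun y => h (f y)) W) :
    ∃ (X : Fin k → ∀ x : M, TangentSpace J x) (X₀ : Fin k → ∀ p : N, TangentSpace J' p),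
      IsSolution J (fun α => pullbackForm J J' f (θ α)) (fun y => h (f y)) X ∧
      (∀ α, IsSmoothVectorField J' (X₀ α)) ∧ (∀ α, IsRelated J J' f (X α) (X₀ α)) ∧
      ((∀ x ∈ tangencySet J (fun α => pullbackForm J J' f (θ α)) (fun y => h (f y)),
        IsTangent J (fun α => pullbackForm J J' f (θ α)) (fun y => h (f y)) x
          (fun α => W α x)) →
        ∀ x ∈ tangencySet J (fun α => pullbackForm J J' f (θ α)) (fun y => h (f y)),
        IsTangent J (fun α => pullbackForm J J' f (θ α)) (fun y => h (f y)) x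
          (fun α => X α x)) := by
  set P := tangencySet J (fun α => pullbackForm J J' f (θ α)) (fun y => h (f y)) with hP
  obtain ⟨X, X₀, hX, hX₀, hrel, ht⟩ := exists_projectable_solution hf hsurj hθ hh hW
    -- The tangency hypothesis on `W` is built into `T`, which is empty if it fails; so one `X` is
    -- constructed in either case and the implication comes afterwards.
    {p | p ∈ f '' P ∧ ∀ x ∈ P, IsTangent J (fun α => pullbackForm J J' f (θ α))
      (fun y => h (f y)) x (fun α => W α x)}
    fun p₀ => by
      obtain ⟨y, rfl⟩ := hsurj p₀
      obtain ⟨σ, U, hU, hxU, hσ, -, hfσ⟩ := exists_local_section hf y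
      refine ⟨σ, U, hU.mem_nhds hxU, hσ, fun p hp => ⟨hfσ p hp, ?_⟩⟩
      rintro ⟨⟨z, hz, rfl⟩, hWt⟩
      -- Saturation: `σ p` lies in the fibre of `z ∈ P`, hence in `P`, where `W` is tangent.
      obtain ⟨X, -, hX, -, -, hXt⟩ := exists_projectable_solution_at hf hsurj hθ hh hz
      obtain ⟨h1, h2⟩ := hXt _ (hfσ _ hp)
      exact hWt _ ⟨h1, X, hX, h2⟩
  exact ⟨X, X₀, hX, hX₀, hrel, fun hWt x hx => ht x hx.1 ⟨⟨x, hx, rfl⟩, hWt⟩⟩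

end Projection

end KSymp

namespace KSymp
open Set Filter Topology Bundle

/-! ### Separation and countability of total spaces, needed for partitions of unity. -/

section Topology

variable {B F : Type*} {V : B → Type*} [TopologicalSpace B] [TopologicalSpace F]
  [TopologicalSpace (TotalSpace F V)] [∀ b, TopologicalSpace (V b)] [FiberBundle F V]

lemma t2Space_totalSpace [T2Space B] [T2Space F] : T2Space (TotalSpace F V) := by
  refine ⟨fun x y hxy => ?_⟩
  by_cases h : x.proj = y.proj
  · let e := trivializationAt F V y.proj
    have hy : y ∈ e.source := FiberBundle.mem_trivializationAt_proj_source
    have hx : x ∈ e.source := by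
      rw [e.mem_source, h]
      exact FiberBundle.mem_baseSet_trivializationAt' _
    obtain ⟨u, v, hu, hv, hxu, hyv, huv⟩ := t2_separation (e.injOn.ne hx hy hxy)
    exact ⟨_, _, e.toOpenPartialHomeomorph.isOpen_inter_preimage hu,
      e.toOpenPartialHomeomorph.isOpen_inter_preimage hv, ⟨hx, hxu⟩, ⟨hy, hyv⟩,
      (huv.preimage _).mono inter_subset_right inter_subset_right⟩
  · obtain ⟨u, v, hu, hv, hxu, hyv, huv⟩ := t2_separation h
    have hc := FiberBundle.continuous_proj F V
    exact ⟨_, _, hu.preimage hc, hv.preimage hc, hxu, hyv, huv.preimage _⟩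

lemma secondCountableTopology_totalSpace [SecondCountableTopology B] [SecondCountableTopology F] :
    SecondCountableTopology (TotalSpace F V) := by
  obtain ⟨s, hs, hsU⟩ := TopologicalSpace.countable_cover_nhds
    (f := fun b : B => (trivializationAt F V b).baseSet) fun b =>
      (trivializationAt F V b).open_baseSet.mem_nhds (FiberBundle.mem_baseSet_trivializationAt' b)
  have := hs.to_subtype
  have (b : s) : SecondCountableTopology (trivializationAt F V (b : B)).source :=
    (trivializationAt F V (b : B)).sourceHomeomorphBaseSetProd.secondCountableTopology
  refine TopologicalSpace.secondCountableTopology_of_countable_cover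
    (fun b : s => (trivializationAt F V (b : B)).open_source) ?_
  refine eq_univ_of_forall fun x => ?_
  obtain ⟨b, hb, hx⟩ := mem_iUnion₂.1 (hsU ▸ mem_univ x.proj)
  exact mem_iUnion.2 ⟨⟨b, hb⟩, (Trivialization.mem_source _).2 hx⟩

lemma sigmaCompactSpace_of_secondCountable {E : Type*} [NormedAddCommGroup E] [NormedSpace ℝ E]
    [FiniteDimensional ℝ E] {H : Type*} [TopologicalSpace H] (J : ModelWithCorners ℝ E H)
    (M : Type*) [TopologicalSpace M] [ChartedSpace H M] [SecondCountableTopology M] :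
    SigmaCompactSpace M := by
  have := Manifold.locallyCompact_of_finiteDimensional (M := M) J
  infer_instance

end Topology

section Instances

variable {k : ℕ} {E : Type*} [NormedAddCommGroup E] [NormedSpace ℝ E]
  {Q : Type*} [TopologicalSpace Q] [ChartedSpace E Q] [IsManifold 𝓘(ℝ, E) ∞ Q]

instance [T2Space Q] : T2Space (KTan k E Q) := t2Space_totalSpace
instance [T2Space Q] : T2Space (KCotan k E Q) := t2Space_totalSpace

instance [FiniteDimensional ℝ E] [SecondCountableTopology Q] :
    SecondCountableTopology (KTan k E Q) :=
  have := FiniteDimensional.proper ℝ ((Fin k → ℝ) →L[ℝ] E)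
  secondCountableTopology_totalSpace
instance [FiniteDimensional ℝ E] [SecondCountableTopology Q] :
    SecondCountableTopology (KCotan k E Q) :=
  have := FiniteDimensional.proper ℝ (E →L[ℝ] (Fin k → ℝ))
  secondCountableTopology_totalSpace

/-- The differential of the bundle projection `(T¹ₖ)*Q → Q`. -/
noncomputable def dprojCotan (p : KCotan k E Q) :
    TangentSpace (modelCotan k E) p →L[ℝ] TangentSpace 𝓘(ℝ, E) p.proj :=
  mfderiv (modelCotan k E) 𝓘(ℝ, E) (fun y : KCotan k E Q => y.proj) p

/-- The tautological 1-forms of `(T¹ₖ)*Q`. -/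
noncomputable def tautForm (α : Fin k) (p : KCotan k E Q) : TangentSpace (modelCotan k E) p →L[ℝ] ℝ :=
  (ContinuousLinearMap.proj (R := ℝ) (φ := fun _ : Fin k => ℝ) α).comp
    ((p.snd : TangentSpace 𝓘(ℝ, E) p.proj →L[ℝ] (Fin k → ℝ)).comp (dprojCotan p))

end Instances
end KSymp

namespace KSymp
open Set Filter Topology Bundle
-- Smoothness of the tautological forms on the `k`-cotangent bundle.
section Taut

variable {k : ℕ} {E : Type*} [NormedAddCommGroup E] [NormedSpace ℝ E]
  {Q : Type*} [TopologicalSpace Q] [ChartedSpace E Q] [IsManifold 𝓘(ℝ, E) ∞ Q]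

lemma extChartAt_kCotan_fst (c p : KCotan k E Q) :
    (extChartAt (modelCotan k E) c p).1 = extChartAt 𝓘(ℝ, E) c.proj p.proj := by
  simp [extChartAt, hom_chart]

/-- The fibre coordinate of a covector is its pull-back by the inverse chart of `Q`; the trivial
factor `ℝᵏ` contributes the identity. -/
lemma extChartAt_kCotan_snd (c p : KCotan k E Q) (hp : p.proj ∈ (chartAt E c.proj).source) (a : E) :
    (extChartAt (modelCotan k E) c p).2 a = (p.snd : E →L[ℝ] (Fin k → ℝ))
      (mfderiv 𝓘(ℝ, E) 𝓘(ℝ, E) (extChartAt 𝓘(ℝ, E) c.proj).symm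
        (extChartAt 𝓘(ℝ, E) c.proj p.proj) a) := by
  have h := TangentBundle.symmL_trivializationAt (I := 𝓘(ℝ, E)) hp
  rw [ModelWithCorners.range_eq_univ, mfderivWithin_univ] at h
  have e : (extChartAt (modelCotan k E) c p).2 =
      ContinuousLinearMap.inCoordinates E (TangentSpace 𝓘(ℝ, E)) (Fin k → ℝ)
        (Bundle.Trivial Q (Fin k → ℝ)) c.proj p.proj c.proj p.proj p.snd := by
    simp [extChartAt, hom_chart]
  have e' : (Trivial.trivialization Q (Fin k → ℝ)).continuousLinearMapAt ℝ p.proj =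
      ContinuousLinearMap.id ℝ (Fin k → ℝ) := by
    exact Trivial.continuousLinearMapAt_trivialization ℝ Q (Fin k → ℝ) p.proj
  rw [e]
  simp only [ContinuousLinearMap.inCoordinates, Trivial.fiberBundle_trivializationAt', h,
    Trivial.continuousLinearMapAt_trivialization]
  rfl

lemma mem_source_of_mem_kCotan_target {c : KCotan k E Q} {y : E × (E →L[ℝ] (Fin k → ℝ))}
    (hy : y ∈ (extChartAt (modelCotan k E) c).target) :
    ((extChartAt (modelCotan k E) c).symm y).proj ∈ (chartAt E c.proj).source := by
  have := (extChartAt (modelCotan k E) c).map_target hy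
  rw [extChartAt_source, FiberBundle.chartedSpace_chartAt] at this
  simp only [mfld_simps] at this ⊢
  exact this.1.1

/-- The coordinate formula `p^α_i dq^i`: the derivative of the inverse base chart in the fibre
coordinate `y.2` matches the one produced by the bundle projection. Smoothness follows, as the
formula is linear in `y`. -/
lemma covectorInChart_tautForm (α : Fin k) (c : KCotan k E Q) {y : E × (E →L[ℝ] (Fin k → ℝ))}
    (hy : y ∈ (extChartAt (modelCotan k E) c).target) (v : E × (E →L[ℝ] (Fin k → ℝ))) :
    covectorInChart (modelCotan k E) (tautForm α) c y v = y.2 v.1 α := by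
  set Ψ := extChartAt (modelCotan k E) c with hΨ
  set φ := extChartAt 𝓘(ℝ, E) c.proj with hφ
  have hs := mem_source_of_mem_kCotan_target hy
  have hΨy : Ψ (Ψ.symm y) = y := Ψ.right_inv hy
  have h1 : φ (Ψ.symm y).proj = y.1 := by rw [hφ, ← extChartAt_kCotan_fst, ← hΨ, hΨy]
  have h2 := extChartAt_kCotan_snd c (Ψ.symm y) hs v.1
  rw [← hΨ, hΨy] at h2
  have hd : (mfderiv (modelCotan k E) 𝓘(ℝ, E) (fun z : KCotan k E Q => z.proj) (Ψ.symm y)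
      (mfderiv 𝓘(ℝ, E × (E →L[ℝ] (Fin k → ℝ))) (modelCotan k E) Ψ.symm y v) : E)
      = mfderiv 𝓘(ℝ, E) 𝓘(ℝ, E) φ.symm y.1 v.1 := by
    have e1 := mfderiv_comp y
      ((Bundle.contMDiff_proj (n := ∞) (IB := 𝓘(ℝ, E)) (CotanFibre k E Q)).mdifferentiableAt
        (x := Ψ.symm y) (by simp)) (mdifferentiableAt_extChartAt_symm (J := modelCotan k E) hy)
    have e3 : y.1 ∈ φ.target := by
      rw [← h1]; exact φ.map_source (by rwa [hφ, extChartAt_source])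
    have e2 := mfderiv_comp y (mdifferentiableAt_extChartAt_symm (J := 𝓘(ℝ, E)) e3)
      (differentiableAt_fst (𝕜 := ℝ) (p := y)).mdifferentiableAt
    have e4 : (fun z : KCotan k E Q => z.proj) ∘ Ψ.symm =ᶠ[𝓝 y] φ.symm ∘ Prod.fst := by
      filter_upwards [extChartAt_target_mem_nhds' (I := modelCotan k E) (x := c) hy] with z hz
      have hz' := mem_source_of_mem_kCotan_target hz
      have : φ (Ψ.symm z).proj = z.1 := by
        rw [hφ, ← extChartAt_kCotan_fst, ← hΨ, Ψ.right_inv hz]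
      simp only [Function.comp_apply, ← this]
      exact (φ.left_inv (by rwa [hφ, extChartAt_source])).symm
    have e5 := e4.mfderiv_eq (I := 𝓘(ℝ, E × (E →L[ℝ] (Fin k → ℝ)))) (I' := 𝓘(ℝ, E))
    have e6 := congrArg (fun l : (E × (E →L[ℝ] (Fin k → ℝ))) →L[ℝ] E => l v)
      (e1.symm.trans (e5.trans e2))
    refine Eq.trans e6 ?_
    rw [mfderiv_eq_fderiv, fderiv_fst]
    rfl
  rw [h2, h1]
  exact congrArg (fun a : E => ((Ψ.symm y).snd : E →L[ℝ] (Fin k → ℝ)) a α) hd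

lemma isSmoothForm_tautForm (α : Fin k):
    IsSmoothForm (modelCotan k E) (tautForm (E := E) (Q := Q) α) := by
  intro c
  have : ContDiff ℝ ∞ fun y : E × (E →L[ℝ] (Fin k → ℝ)) =>
      (ContinuousLinearMap.proj (R := ℝ) (φ := fun _ : Fin k => ℝ) α).comp
        (y.2.comp (ContinuousLinearMap.fst ℝ E (E →L[ℝ] (Fin k → ℝ)))) :=
    contDiff_const.clm_comp (contDiff_snd.clm_comp contDiff_const)
  refine this.contDiffOn.congr fun y hy => ?_
  ext v
  · exact covectorInChart_tautForm α c hy (v, 0)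
  · exact covectorInChart_tautForm α c hy (0, v)

end Taut
end KSymp

namespace KSymp
open Set Filter Topology Bundle
-- The Legendre map, and descent of the energy and the Cartan forms to `P₀`.
section Lagr

variable {k : ℕ} {E : Type*} [NormedAddCommGroup E] [NormedSpace ℝ E]
  {Q : Type*} [TopologicalSpace Q] [ChartedSpace E Q]

lemma sum_slot (w : (Fin k → ℝ) →L[ℝ] E) :
    ∑ α, slot (E := E) α (w (Pi.single α 1)) = w := by
  ext v
  rw [sum_apply]
  have h : v = ∑ α, v α • (Pi.single α 1 : Fin k → ℝ) := pi_eq_sum_univ' v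
  conv_rhs => rw [h, map_sum]
  refine Finset.sum_congr rfl fun α _ => ?_
  rw [map_smul]
  rfl

section

variable {L : KTan k E Q → ℝ}

/-- The momenta are the values of the fibre derivative on the slots, and the slots span by
`sum_slot`. -/
lemma fderiv_eq_of_legendre_eq {q : Q} {w w' : (Fin k → ℝ) →L[ℝ] E}
    (h : legendre L (fibreIncl q w) = legendre L (fibreIncl q w')) :
    fderiv ℝ (fun w => L (fibreIncl q w)) w = fderiv ℝ (fun w => L (fibreIncl q w)) w' := by
  have h' := eq_of_heq (TotalSpace.mk.inj h).2
  ext v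
  rw [← sum_slot v, map_sum, map_sum]
  exact Finset.sum_congr rfl fun α _ =>
    congrFun (congrArg (fun l : E →L[ℝ] (Fin k → ℝ) => l (v (Pi.single α 1))) h') α

lemma surjective_legendre0 : Function.Surjective (legendre0 L) := by
  rintro ⟨_, x, rfl⟩
  exact ⟨x, rfl⟩

end

variable [IsManifold 𝓘(ℝ, E) ∞ Q]

lemma contMDiff_fibreIncl (q : Q) :
    ContMDiff 𝓘(ℝ, (Fin k → ℝ) →L[ℝ] E) (modelTan k E) ∞ (fibreIncl (k := k) (E := E) q) := by
  intro w
  refine (contMDiffAt_hom_bundle (fibreIncl (k := k) (E := E) q)).2 ⟨contMDiffAt_const, ?_⟩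
  have : ContDiff ℝ ∞ fun w : (Fin k → ℝ) →L[ℝ] E =>
      (((trivializationAt E (TangentSpace 𝓘(ℝ, E)) q).continuousLinearMapAt ℝ q : E →L[ℝ] E).comp
        w).comp ((trivializationAt (Fin k → ℝ) (Bundle.Trivial Q (Fin k → ℝ)) q).symmL ℝ q :
          (Fin k → ℝ) →L[ℝ] (Fin k → ℝ)) :=
    (contDiff_const.clm_comp contDiff_id).clm_comp contDiff_const
  exact this.contMDiff w

/-- The trivialization at `q` is the identity on the fibre at `q`. -/
lemma eq_fibreIncl (q : Q) (x : KTan k E Q) (h : x.proj = q) :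
    x = fibreIncl q (trivializationAt _ (TanFibre k E Q) q x).2 := by
  subst h
  have h1 := TangentBundle.continuousLinearMapAt_trivializationAt (I := 𝓘(ℝ, E))
    (mem_chart_source E x.proj)
  rw [mfderiv_extChartAt_self] at h1
  have : (trivializationAt _ (TanFibre k E Q) x.proj x).2 = fibrePart x := by
    rw [hom_trivializationAt_apply]
    simp only [ContinuousLinearMap.inCoordinates, Trivial.fiberBundle_trivializationAt', h1,
      Trivial.symmL_trivialization]
    rfl
  rw [this]
  rfl

variable {L : KTan k E Q → ℝ}

lemma differentiable_fibre (hL : ContMDiff (modelTan k E) 𝓘(ℝ) ∞ L) (q : Q) :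
    Differentiable ℝ fun w : (Fin k → ℝ) →L[ℝ] E => L (fibreIncl q w) :=
  (hL.comp (contMDiff_fibreIncl q)).contDiff.differentiable (by simp)

lemma diff_vertLift (hL : ContMDiff (modelTan k E) 𝓘(ℝ) ∞ L) (α : Fin k) (x : KTan k E Q)
    (w : TangentSpace 𝓘(ℝ, E) x.proj) :
    diff L x (vertLift α x w) =
      fderiv ℝ (fun w => L (fibreIncl x.proj w)) (fibrePart x) (slot (E := E) α w) := by
  have h := mvfderiv_comp_apply hL (contMDiff_fibreIncl (k := k) (E := E) x.proj) (fibrePart x)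
    (slot (E := E) α w)
  exact h.symm.trans (congrArg (fun l : ((Fin k → ℝ) →L[ℝ] E) →L[ℝ] ℝ => l (slot (E := E) α w))
    (mfderiv_eq_fderiv (f := fun w => L (fibreIncl x.proj w)) (x := fibrePart x)))

lemma diff_vertLift_eq (hL : ContMDiff (modelTan k E) 𝓘(ℝ) ∞ L) (α : Fin k) (x : KTan k E Q)
    (w : TangentSpace 𝓘(ℝ, E) x.proj) :
    diff L x (vertLift α x w) = ((legendre L x).snd : E →L[ℝ] (Fin k → ℝ)) w α :=
  diff_vertLift hL α x w

lemma energy_eq_sum (hL : ContMDiff (modelTan k E) 𝓘(ℝ) ∞ L) (x : KTan k E Q) :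
    energy L x = ∑ α, ((legendre L x).snd : E →L[ℝ] (Fin k → ℝ)) (velocity α x) α - L x := by
  have h (l : (E × ((Fin k → ℝ) →L[ℝ] E)) →L[ℝ] ℝ) (f : Fin k → E × ((Fin k → ℝ) →L[ℝ] E)) :
      l (∑ α, f α) = ∑ α, l (f α) := map_sum l f _
  refine congrArg (· - L x) ((h _ _).trans (Finset.sum_congr rfl fun α _ => ?_))
  exact diff_vertLift_eq hL α x (velocity α x)

lemma energy_fibreIncl (hL : ContMDiff (modelTan k E) 𝓘(ℝ) ∞ L) (q : Q)
    (w : (Fin k → ℝ) →L[ℝ] E) :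
    energy L (fibreIncl q w) =
      fderiv ℝ (fun w => L (fibreIncl q w)) w w - L (fibreIncl q w) := by
  rw [energy_eq_sum hL]
  congr 1
  have h := map_sum (fderiv ℝ (fun w => L (fibreIncl q w)) w)
    (fun α => slot (E := E) α (w (Pi.single α 1))) Finset.univ
  rw [sum_slot] at h
  exact h.symm

/-- Along the curve the fibre derivative of `L` is a constant `D`, so the energy is `D(w) - L` and
its derivative is `D(w') - D(w') = 0`. -/
lemma energy_eq_of_curve (hL : ContMDiff (modelTan k E) 𝓘(ℝ) ∞ L) {q : Q}
    {w w' : ℝ → ((Fin k → ℝ) →L[ℝ] E)} (hw : ∀ t ∈ Icc (0 : ℝ) 1, HasDerivAt w (w' t) t)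
    (h : ∀ t ∈ Icc (0 : ℝ) 1, legendre L (fibreIncl q (w t)) = legendre L (fibreIncl q (w 0))) :
    energy L (fibreIncl q (w 1)) = energy L (fibreIncl q (w 0)) := by
  set D := fderiv ℝ (fun w => L (fibreIncl q w)) (w 0) with hD
  have hE : ∀ t ∈ Icc (0 : ℝ) 1,
      energy L (fibreIncl q (w t)) = D (w t) - L (fibreIncl q (w t)) := by
    intro t ht
    rw [energy_fibreIncl hL, fderiv_eq_of_legendre_eq (h t ht)]
  have hd : ∀ t ∈ Icc (0 : ℝ) 1, HasDerivAt (fun t => D (w t) - L (fibreIncl q (w t))) 0 t := by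
    intro t ht
    have h1 := D.hasFDerivAt.comp_hasDerivAt t (hw t ht)
    have h2 := (differentiable_fibre hL q (w t)).hasFDerivAt.comp_hasDerivAt t (hw t ht)
    rw [fderiv_eq_of_legendre_eq (h t ht)] at h2
    rw [← sub_self (D (w' t))]
    exact h1.sub h2
  rw [hE 1 (by simp), hE 0 (by simp)]
  exact constant_of_has_deriv_right_zero (fun t ht => (hd t ht).continuousAt.continuousWithinAt)
    (fun t ht => (hd t (Ico_subset_Icc_self ht)).hasDerivWithinAt) 1 (by simp)

variable {d : ℕ} [ChartedSpace (EuclideanSpace ℝ (Fin d)) (imageP0 L)]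

lemma IsAlmostRegular.contMDiff_legendre (hL : IsAlmostRegular L d) :
    ContMDiff (modelTan k E) (modelCotan k E) ∞ (legendre L) :=
  hL.submanifold.contMDiff.comp hL.submersion.contMDiff

/-- The Legendre map is smooth, being a submersion followed by an embedding, so the pairing of
momenta with velocities is a smooth bundle evaluation. -/
lemma IsAlmostRegular.contMDiff_energy (hL : IsAlmostRegular L d) :
    ContMDiff (modelTan k E) 𝓘(ℝ) ∞ (energy L) := by
  have h1 (α : Fin k) : ContMDiff (modelTan k E) ((𝓘(ℝ, E)).prod 𝓘(ℝ, E)) ∞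
      fun x : KTan k E Q => TotalSpace.mk' E (E := TangentSpace 𝓘(ℝ, E)) x.proj (velocity α x) := by
    refine ContMDiff.clm_bundle_apply (F₁ := Fin k → ℝ) (E₁ := Bundle.Trivial Q (Fin k → ℝ))
      (IB := 𝓘(ℝ, E)) (b := fun x : KTan k E Q => x.proj) (ϕ := fun x => x.snd)
      (v := fun x => (Pi.single α 1 : Fin k → ℝ)) contMDiff_id ?_
    intro x
    exact contMDiffAt_totalSpace.2 ⟨Bundle.contMDiffAt_proj _, contMDiffAt_const⟩
  have h2 (α : Fin k) : ContMDiff (modelTan k E) 𝓘(ℝ) ∞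
      fun x : KTan k E Q => ((legendre L x).snd : E →L[ℝ] (Fin k → ℝ)) (velocity α x) α := by
    have h3 : ContMDiff (modelTan k E) ((𝓘(ℝ, E)).prod 𝓘(ℝ, Fin k → ℝ)) ∞ fun x : KTan k E Q =>
        TotalSpace.mk' (Fin k → ℝ) (E := Bundle.Trivial Q (Fin k → ℝ)) x.proj
          ((legendre L x).snd (velocity α x)) :=
      ContMDiff.clm_bundle_apply (F₂ := Fin k → ℝ) (E₂ := Bundle.Trivial Q (Fin k → ℝ))
        (E₁ := TangentSpace 𝓘(ℝ, E)) (F₁ := E)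
        (IB := 𝓘(ℝ, E)) (b := fun x : KTan k E Q => x.proj) (ϕ := fun x => (legendre L x).snd)
        hL.contMDiff_legendre (h1 α)
    intro x
    have h4 := (contMDiffAt_totalSpace.1 (h3 x)).2
    exact (ContinuousLinearMap.proj (R := ℝ)
      (φ := fun _ : Fin k => ℝ) α).contDiff.contMDiff.contMDiffAt.comp x h4
  have : energy L = fun x => _ := funext (energy_eq_sum hL.smooth)
  rw [this]
  exact (contMDiff_finsetSum fun α _ => h2 α).sub hL.smooth

lemma IsAlmostRegular.energy_locally_constant (hL : IsAlmostRegular L d) (x : KTan k E Q) :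
    ∀ᶠ y in 𝓝[legendre0 L ⁻¹' {legendre0 L x}] x, energy L x = energy L y := by
  obtain ⟨F, _, _, ⟨c⟩⟩ := exists_submersionChart (hL.submersion.isSubmersionAt x)
  obtain ⟨U, hU, hc⟩ := c.exists_curve_in_fibre
  filter_upwards [mem_nhdsWithin_of_mem_nhds hU, self_mem_nhdsWithin] with y hyU hy
  obtain ⟨γ, h0, h1, hγ⟩ := hc y hyU hy
  have hleg : ∀ t ∈ Icc (0 : ℝ) 1, legendre L (γ t) = legendre L x := fun t ht =>
    congrArg Subtype.val (hγ t ht).2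
  -- The Legendre map covers the identity of `Q`, so a curve in its fibre stays over one base point
  -- and is a curve `w` in a vector space.
  have hproj : ∀ t ∈ Icc (0 : ℝ) 1, (γ t).proj = x.proj := fun t ht =>
    congrArg (fun p : KCotan k E Q => p.proj) (hleg t ht)
  set w : ℝ → ((Fin k → ℝ) →L[ℝ] E) := fun t => (trivializationAt _ (TanFibre k E Q) x.proj (γ t)).2
  have hw : ∀ t ∈ Icc (0 : ℝ) 1, fibreIncl x.proj (w t) = γ t := fun t ht =>
    (eq_fibreIncl _ _ (hproj t ht)).symm
  have hd : ∀ t ∈ Icc (0 : ℝ) 1, HasDerivAt w (deriv w t) t := by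
    intro t ht
    have h2 := (contMDiffAt_totalSpace.1 (hγ t ht).1).2
    rw [hproj t ht] at h2
    exact (h2.contDiffAt.differentiableAt (by simp)).hasDerivAt
  have h := energy_eq_of_curve hL.smooth hd fun t ht => by
    rw [hw t ht, hw 0 (by simp), hleg t ht, hleg 0 (by simp)]
  rw [hw 1 (by simp), hw 0 (by simp), h0, h1] at h
  exact h.symm

/-- Local constancy along the fibres becomes constancy because the fibres are connected. -/
lemma IsAlmostRegular.energy_eq (hL : IsAlmostRegular L d) {x y : KTan k E Q}
    (h : legendre0 L x = legendre0 L y) : energy L x = energy L y := by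
  refine (hL.connected (legendre0 L y)).isPreconnected.induction₂
    (fun x y => energy L x = energy L y) (fun z hz => ?_) (fun _ _ _ _ _ _ => Eq.trans)
    (fun _ _ _ _ => Eq.symm) h rfl
  have := hL.energy_locally_constant z
  rwa [show legendre0 L z = legendre0 L y from hz] at this

variable (L) in
/-- The function on the image of the Legendre map induced by the energy. -/
noncomputable def hamiltonian (p : imageP0 L) : ℝ :=
  energy L (surjective_legendre0 p).choose

lemma IsAlmostRegular.energy_eq_hamiltonian (hL : IsAlmostRegular L d) :
    energy L = fun x => hamiltonian L (legendre0 L x) :=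
  funext fun x => hL.energy_eq (surjective_legendre0 (legendre0 L x)).choose_spec.symm

variable (L d) in
/-- The restrictions of the tautological forms to the image of the Legendre map. -/
noncomputable def restrTautForm (α : Fin k) : ∀ p : imageP0 L, TangentSpace (𝓡 d) p →L[ℝ] ℝ :=
  pullbackForm (𝓡 d) (modelCotan k E) Subtype.val (tautForm α)

lemma IsAlmostRegular.isSmoothForm_restrTautForm [IsManifold (𝓡 d) ∞ (imageP0 L)]
    (hL : IsAlmostRegular L d)
    (α : Fin k) : IsSmoothForm (𝓡 d) (restrTautForm L d α) :=
  (isSmoothForm_tautForm α).pullback hL.submanifold.contMDiff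

/-- Both forms apply the momentum `p^α` of the image point to the projection of `v` to `Q`; the
projections agree since the Legendre map covers the identity. -/
lemma IsAlmostRegular.cartanOne_eq (hL : IsAlmostRegular L d) (α : Fin k) :
    cartanOne L α = pullbackForm (modelTan k E) (𝓡 d) (legendre0 L) (restrTautForm L d α) := by
  funext x
  ext v
  have h1 := mfderiv_comp x (hL.submanifold.contMDiff.mdifferentiableAt (x := legendre0 L x)
    (by simp)) (hL.submersion.contMDiff.mdifferentiableAt (x := x) (by simp))
  have h2 := mfderiv_comp x ((Bundle.contMDiff_proj (n := ∞) (IB := 𝓘(ℝ, E))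
    (CotanFibre k E Q)).mdifferentiableAt (x := legendre L x) (by simp))
    (hL.contMDiff_legendre.mdifferentiableAt (x := x) (by simp))
  have h3 : (dproj x v : E) = dprojCotan (legendre L x) (mfderiv (𝓡 d) (modelCotan k E)
      Subtype.val (legendre0 L x) (mfderiv (modelTan k E) (𝓡 d) (legendre0 L) x v)) := by
    have h4 := congrArg (fun l : (E × ((Fin k → ℝ) →L[ℝ] E)) →L[ℝ]
      (E × (E →L[ℝ] (Fin k → ℝ))) => l v) h1
    have h5 := congrArg (fun l : (E × ((Fin k → ℝ) →L[ℝ] E)) →L[ℝ] E => l v) h2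
    exact h5.trans (congrArg (fun u : E × (E →L[ℝ] (Fin k → ℝ)) =>
      (dprojCotan (legendre L x) : (E × (E →L[ℝ] (Fin k → ℝ))) →L[ℝ] E) u) h4)
  refine (diff_vertLift_eq hL.smooth α x (dproj x v)).trans ?_
  exact congrArg (fun a : E => ((legendre L x).snd : E →L[ℝ] (Fin k → ℝ)) a α) h3

lemma IsAlmostRegular.contMDiff_hamiltonian (hL : IsAlmostRegular L d) :
    ContMDiff (𝓡 d) 𝓘(ℝ) ∞ (hamiltonian L) := by
  refine contMDiff_of_comp_submersion hL.submersion surjective_legendre0 ?_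
  have := hL.contMDiff_energy
  rw [hL.energy_eq_hamiltonian] at this
  exact this

end Lagr
end KSymp

namespace KSymp
open Set Filter Topology Bundle
-- Translation to the constraints of the Lagrangian system, and conclusion.
section Constraints

variable {k : ℕ} {E : Type*} [NormedAddCommGroup E] [NormedSpace ℝ E]
  {Q : Type*} [TopologicalSpace Q] [ChartedSpace E Q] [IsManifold 𝓘(ℝ, E) ∞ Q]

lemma isSmoothVectorField_zero :
    IsSmoothVectorField (modelTan k E) (0 : VField k E Q) :=
  contMDiff_zeroSection ℝ (TangentSpace (modelTan k E) : KTan k E Q → Type _)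

variable (L : KTan k E Q → ℝ)

lemma isVerticalKer_zero : IsVerticalKer L (0 : Fin k → VField k E Q) := by
  refine ⟨fun α => isSmoothVectorField_zero, fun α x => ?_, fun x w => ?_⟩
  · exact map_zero (dproj x : (E × ((Fin k → ℝ) →L[ℝ] E)) →L[ℝ] E)
  · refine Finset.sum_eq_zero fun α _ => ?_
    exact neg_eq_zero.2 (extDerivForm_zero_left _ x w)

variable {L}

lemma IsLagrangianOn.add_isVerticalKer {S : Set (KTan k E Q)} {X V : Fin k → VField k E Q}
    (hX : IsLagrangianOn L S X) (hV : IsVerticalKer L V) : IsLagrangianOn L S (X + V) := by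
  refine ⟨fun α => (hX.1 α).add (hV.1 α), fun x hx w => ?_⟩
  rw [← hX.2 x hx w, ← add_zero (omega L X x w), ← hV.2.2 x w]
  unfold omega
  rw [← Finset.sum_add_distrib]
  refine Finset.sum_congr rfl fun α _ => ?_
  exact (congrArg Neg.neg (extDerivForm_add_left _ x (X α x) (V α x) w)).trans (neg_add _ _)

lemma isLagrangianOn_iff {W : Fin k → VField k E Q} :
    IsLagrangianOn L (constraintP1 L) W ↔
      IsSolution (modelTan k E) (cartanOne L) (energy L) W := Iff.rfl

section Projectable

variable {d : ℕ} [ChartedSpace (EuclideanSpace ℝ (Fin d)) (imageP0 L)]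

lemma IsAlmostRegular.cartanOne_eq' (hL : IsAlmostRegular L d) :
    cartanOne L = fun α => pullbackForm (modelTan k E) (𝓡 d) (legendre0 L) (restrTautForm L d α) :=
  funext hL.cartanOne_eq

variable [IsManifold (𝓡 d) ∞ (imageP0 L)]

lemma IsAlmostRegular.isProjFun_zeta1 (hL : IsAlmostRegular L d) {Z : VField k E Q}
    (hZ : IsProjField L d Z) : IsProjFun L d (zeta1 L Z) := by
  obtain ⟨Z₀, hZ₀, hrel⟩ := hZ
  refine ⟨_, contMDiff_mvfderiv_apply hL.contMDiff_hamiltonian hZ₀, fun x => ?_⟩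
  unfold zeta1 diff
  rw [hL.energy_eq_hamiltonian]
  exact congrFun (contraction_comp hL.submersion.contMDiff hL.contMDiff_hamiltonian hrel) x

lemma IsAlmostRegular.isProjFun_zeta2 (hL : IsAlmostRegular L d) {Z : VField k E Q}
    (hZ : IsProjField L d Z) {W : Fin k → VField k E Q} {α : Fin k} (hW : IsProjField L d (W α)) :
    IsProjFun L d (zeta2 L W Z α) := by
  obtain ⟨Z₀, hZ₀, hrel⟩ := hZ
  obtain ⟨W₀, hW₀, hrelW⟩ := hW
  refine ⟨_, contMDiff_mvfderiv_apply
    (contMDiff_mvfderiv_apply hL.contMDiff_hamiltonian hZ₀) hW₀, fun x => ?_⟩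
  unfold zeta2 zeta1 diff
  rw [hL.energy_eq_hamiltonian]
  rw [← hrelW x]
  exact mvfderiv_contraction_comp hL.submersion.contMDiff hL.contMDiff_hamiltonian hZ₀ hrel x _

end Projectable

variable [T2Space Q] [SecondCountableTopology Q] [FiniteDimensional ℝ E]

instance : SigmaCompactSpace (KTan k E Q) :=
  sigmaCompactSpace_of_secondCountable (modelTan k E) _

/-- Testing on `k`-vector fields with one nonzero component, which may take any value at a given
point, separates the `k` forms and makes the condition pointwise. -/
lemma mem_annihilator_iff {Z : VField k E Q} :
    Z ∈ annihilator L ↔ InKernel (modelTan k E) (cartanOne L) Z := by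
  refine and_congr_right fun hZ => ⟨fun h x α u => ?_, fun h Y hY x => ?_⟩
  · obtain ⟨Y, hY, hYx⟩ := exists_smooth_vectorField_eq (J := modelTan k E) x u
    have h1 := h (Pi.single α Y) (fun β => by
      by_cases hβ : β = α
      · subst hβ; simpa using hY
      · simpa [hβ] using isSmoothVectorField_zero) x
    unfold omega at h1
    rw [Finset.sum_eq_single α] at h1
    · rw [Pi.single_eq_same, hYx] at h1
      exact neg_eq_zero.1 h1
    · intro β _ hβ
      rw [Pi.single_eq_of_ne hβ]
      exact neg_eq_zero.2 (extDerivForm_zero_left _ x _)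
    · simp
  · exact Finset.sum_eq_zero fun α _ => neg_eq_zero.2 (h x α _)

lemma constraintP2_eq :
    constraintP2 L = tangencySet (modelTan k E) (cartanOne L) (energy L) := by
  ext x
  refine and_congr Iff.rfl (exists_congr fun W => and_congr Iff.rfl ?_)
  exact forall_congr' fun Z => imp_congr mem_annihilator_iff Iff.rfl

lemma mem_zeroLocus_annihilator_iff {W : Fin k → VField k E Q} {x : KTan k E Q} :
    x ∈ zeroLocus L W (annihilator L) ↔
      x ∈ constraintP1 L ∧ IsTangent (modelTan k E) (cartanOne L) (energy L) x (fun α => W α x) :=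
  and_congr Iff.rfl (forall_congr' fun _ => imp_congr mem_annihilator_iff Iff.rfl)

variable {d : ℕ} [ChartedSpace (EuclideanSpace ℝ (Fin d)) (imageP0 L)]
  [IsManifold (𝓡 d) ∞ (imageP0 L)]

lemma IsAlmostRegular.exists_mem_projAnnihilator (hL : IsAlmostRegular L d) (x : KTan k E Q)
    {Z : VField k E Q} (hZ : Z ∈ annihilator L) :
    ∃ Z' ∈ projAnnihilator L d, Z' x = Z x ∧ zeta1 L Z' x = zeta1 L Z x ∧
      (x ∈ constraintP1 L → ∀ (W : Fin k → VField k E Q) (α : Fin k),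
        zeta2 L W Z' α x = zeta2 L W Z α x) := by
  have := sigmaCompactSpace_of_secondCountable (𝓡 d) (imageP0 L)
  have hZ' := mem_annihilator_iff.1 hZ
  rw [hL.cartanOne_eq'] at hZ'
  obtain ⟨Z', Z₀, h1, h2, hrel, hx⟩ := exists_projectable_inKernel hL.submersion
    surjective_legendre0 hL.isSmoothForm_restrTautForm hZ' x
  rw [← hL.cartanOne_eq'] at h1
  refine ⟨Z', ⟨mem_annihilator_iff.2 h1, Z₀, h2.1, hrel⟩, hx, ?_, fun hP W α => ?_⟩
  · unfold zeta1
    rw [hx]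
  · have hs : ∀ α, IsSmoothForm (modelTan k E) (cartanOne L α) := fun α => by
      rw [hL.cartanOne_eq]
      exact (hL.isSmoothForm_restrTautForm α).pullback hL.submersion.contMDiff
    have h := mvfderiv_contraction_congr hs hL.contMDiff_energy h1
      (mem_annihilator_iff.1 hZ) hx hP
    exact congrArg (fun l : (E × ((Fin k → ℝ) →L[ℝ] E)) →L[ℝ] ℝ => l (W α x)) h

lemma zeroLocus_projAnnihilator (hL : IsAlmostRegular L d) (W : Fin k → VField k E Q) :
    zeroLocus L W (projAnnihilator L d) = zeroLocus L W (annihilator L) := by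
  refine Subset.antisymm (fun x hx => ⟨hx.1, fun Z hZ α => ?_⟩)
    fun x hx => ⟨hx.1, fun Z hZ => hx.2 Z hZ.1⟩
  obtain ⟨Z', hZ', -, -, h⟩ := hL.exists_mem_projAnnihilator x hZ
  rw [← h hx.1, hx.2 Z' hZ' α]

lemma IsAlmostRegular.exists_projectable_lagrangian (hL : IsAlmostRegular L d)
    {W : Fin k → VField k E Q} (hW : IsLagrangianOn L (constraintP1 L) W) :
    ∃ X : Fin k → VField k E Q, IsLagrangianOn L (constraintP1 L) X ∧
      (∀ α, IsProjField L d (X α)) ∧ (zeroLocus L W (annihilator L) = constraintP2 L →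
        zeroLocus L X (projAnnihilator L d) = constraintP2 L) := by
  have := sigmaCompactSpace_of_secondCountable (𝓡 d) (imageP0 L)
  have hW' := isLagrangianOn_iff.1 hW
  rw [hL.cartanOne_eq', hL.energy_eq_hamiltonian] at hW'
  obtain ⟨X, X₀, hX, hX₀, hrel, ht⟩ := exists_projectable_solution_on hL.submersion
    surjective_legendre0 hL.isSmoothForm_restrTautForm hL.contMDiff_hamiltonian hW'
  rw [← hL.cartanOne_eq', ← hL.energy_eq_hamiltonian] at hX ht
  rw [← constraintP2_eq] at ht
  refine ⟨X, hX, fun α => ⟨X₀ α, hX₀ α, hrel α⟩, fun h => ?_⟩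
  rw [zeroLocus_projAnnihilator hL]
  -- One inclusion is automatic: where its constraints vanish, `X` itself witnesses membership in
  -- `P₂`.
  refine Subset.antisymm (fun x hx => ⟨hx.1, X, hX, hx.2⟩) fun x hx => ?_
  refine mem_zeroLocus_annihilator_iff.2 ⟨hx.1, ht (fun y hy => ?_) x hx⟩
  rw [← h] at hy
  exact (mem_zeroLocus_annihilator_iff.1 hy).2

lemma IsAlmostRegular.exists_projectable_lagrangian_at (hL : IsAlmostRegular L d)
    {x : KTan k E Q} (hx : x ∈ constraintP2 L) :
    ∃ X : Fin k → VField k E Q, IsLagrangianOn L (constraintP1 L) X ∧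
      (∀ α, IsProjField L d (X α)) ∧ x ∈ zeroLocus L X (projAnnihilator L d) := by
  have := sigmaCompactSpace_of_secondCountable (𝓡 d) (imageP0 L)
  have hx' := hx
  rw [constraintP2_eq, hL.cartanOne_eq', hL.energy_eq_hamiltonian] at hx'
  obtain ⟨X, X₀, hX, hX₀, hrel, ht⟩ := exists_projectable_solution_at hL.submersion
    surjective_legendre0 hL.isSmoothForm_restrTautForm hL.contMDiff_hamiltonian hx'
  rw [← hL.cartanOne_eq', ← hL.energy_eq_hamiltonian] at hX ht
  refine ⟨X, hX, fun α => ⟨X₀ α, hX₀ α, hrel α⟩, ?_⟩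
  rw [zeroLocus_projAnnihilator hL]
  exact mem_zeroLocus_annihilator_iff.2 ⟨hx.1, (ht x rfl).2⟩

end Constraints
end KSymp

theorem mainTheorem6
    {k d : ℕ} {E : Type*} [NormedAddCommGroup E] [NormedSpace ℝ E] [FiniteDimensional ℝ E]
    {Q : Type*} [TopologicalSpace Q] [T2Space Q] [SecondCountableTopology Q]
    [ChartedSpace E Q] [IsManifold 𝓘(ℝ, E) ∞ Q]
    (L : KSymp.KTan k E Q → ℝ)
    [ChartedSpace (EuclideanSpace ℝ (Fin d)) (KSymp.imageP0 L)]
    [IsManifold (𝓡 d) ∞ (KSymp.imageP0 L)]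
    (hL : KSymp.IsAlmostRegular L d) :
    -- with a projectable solution and projectable generators, the constraints are projectable
    (∀ X V : Fin k → KSymp.VField k E Q,
      KSymp.IsLagrangianOn L (KSymp.constraintP1 L) X → KSymp.IsVerticalKer L V →
      (∀ α, KSymp.IsProjField L d ((X + V) α)) →
      ∀ Z ∈ KSymp.projAnnihilator L d,
        KSymp.IsProjFun L d (KSymp.zeta1 L Z) ∧
        ∀ α, KSymp.IsProjFun L d (KSymp.zeta2 L (X + V) Z α)) ∧
    -- projectable generators give all the values of the constraints
    (∀ (x : KSymp.KTan k E Q), ∀ Z ∈ KSymp.annihilator L, ∃ Z' ∈ KSymp.projAnnihilator L d,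
      Z' x = Z x ∧ KSymp.zeta1 L Z' x = KSymp.zeta1 L Z x ∧
      (x ∈ KSymp.constraintP1 L → ∀ (W : Fin k → KSymp.VField k E Q) (α : Fin k),
        KSymp.zeta2 L W Z' α x = KSymp.zeta2 L W Z α x)) ∧
    -- any choice of solution can be replaced by a projectable one
    (∀ X V : Fin k → KSymp.VField k E Q,
      KSymp.IsLagrangianOn L (KSymp.constraintP1 L) X → KSymp.IsVerticalKer L V →
      ∃ X' V' : Fin k → KSymp.VField k E Q,
        KSymp.IsLagrangianOn L (KSymp.constraintP1 L) X' ∧ KSymp.IsVerticalKer L V' ∧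
        (∀ α, KSymp.IsProjField L d ((X' + V') α)) ∧
        (KSymp.zeroLocus L (X + V) (KSymp.annihilator L) = KSymp.constraintP2 L →
          KSymp.zeroLocus L (X' + V') (KSymp.projAnnihilator L d) = KSymp.constraintP2 L)) ∧
    -- every point of `P₂` is reached by projectable constraints
    (∀ x ∈ KSymp.constraintP2 L, ∃ X V : Fin k → KSymp.VField k E Q,
      KSymp.IsLagrangianOn L (KSymp.constraintP1 L) X ∧ KSymp.IsVerticalKer L V ∧
      (∀ α, KSymp.IsProjField L d ((X + V) α)) ∧
      x ∈ KSymp.zeroLocus L (X + V) (KSymp.projAnnihilator L d)) := by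
  refine ⟨fun X V _ _ hW Z hZ => ⟨hL.isProjFun_zeta1 hZ.2, fun α => hL.isProjFun_zeta2 hZ.2 (hW α)⟩,
    fun x Z hZ => hL.exists_mem_projAnnihilator x hZ, fun X V hX hV => ?_, fun x hx => ?_⟩
  -- Adding `V` to `X` gives another Lagrangian field; its projectable replacement is taken as `X'`,
  -- with `V' = 0`.
  · obtain ⟨X', h1, h2, h3⟩ := hL.exists_projectable_lagrangian (hX.add_isVerticalKer hV)
    refine ⟨X', 0, h1, KSymp.isVerticalKer_zero L, ?_, ?_⟩ <;> simpa only [add_zero]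
  · obtain ⟨X, h1, h2, h3⟩ := hL.exists_projectable_lagrangian_at hx
    refine ⟨X, 0, h1, KSymp.isVerticalKer_zero L, ?_, ?_⟩ <;> simpa only [add_zero]
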